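/- Let $V$ be a real vector space of dimension $n+2$ with a scalar product $\langle\cdot,\cdot\rangle$ (a non-degenerate symmetric bilinear form) of index one, i.e. with Gram matrix $\mathrm{diag}(1,\dots,1,-1)$ in a suitable basis. Call a subspace of $V$ euclidean if the scalar product is positive definite on it (the zero subspace is allowed), pseudo-euclidean if the restricted scalar product is non-degenerate of index one, and isotropic if the restricted scalar product is degenerate with one-dimensional radical. The Möbius space $S^n$ is the set of points $[x]$ of the projective space $\mathbb P(V)$ with $\langle x,x\rangle=0$; the Möbius group $G_n$ is the group of all projective transformations of $\mathbb P(V)$ that preserve $S^n$. For $k\ge 0$, a $k$-sphere is the intersection of $S^n$ with (the projectivization of) a pseudo-euclidean subspace of dimension $k+2$; a hypersphere is an $(n-1)$-sphere. Let $n>m\ge l\ge 0$. Let $S_1^m$ be an $m$-sphere and $S_2^l$ an $l$-sphere, defined by the pseudo-euclidean subspaces $W$ ($\dim W=m+2$) and $U$ ($\dim U=l+2$), and suppose that the pair is in general position: no hypersphere contains $S_1\cup S_2$. Let $p_{2,1}\colon W^\perp\to U^\perp$ and $p_{1,2}\colon U^\perp\to W^\perp$ be the restrictions of the orthogonal projections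 belonging to $V=U\oplus U^\perp=W\oplus W^\perp$, and $A=p_{1,2}\circ p_{2,1}\in\mathrm{End}(W^\perp)$. The subspheres are called separable by hyperspheres if there are hyperspheres $\Sigma_1\supseteq S_1$ and $\Sigma_2\supseteq S_2$ with $\Sigma_1\cap\Sigma_2=\emptyset$ (and, if $n=1$, where hyperspheres are pairs of points of a circle, such that moreover $\Sigma_2$ lies in one of the two arcs of $S^1\setminus\Sigma_1$); they are called interlaced if $S_1\cap S_2=\emptyset$ and they are not separable by hyperspheres. **Theorem.** (a) $A$ is self-adjoint, and $W^\perp$ has an orthonormal basis of eigenvectors of $A$; its eigenvalues, counted with multiplicity, are $\alpha_1\ge\alpha_2\ge\dots\ge\alpha_{n-m}\ge 0$. (b) These eigenvalues are a complete system of Möbius invariants: if $(S_1^m,S_2^l)$ and $(\hat S_1^m,\hat S_2^l)$ are two pairs in general position, with eigenvalues $\alpha_i$ and $\hat\alpha_i$, then there is a $g\in G_n$ with $gS_1=\hat S_1$ and $gS_2=\hat S_2$ if and only if $\alpha_i=\hat\alpha_i$ for $i=1,\dots,n-m$. (c) The mutual position of the spheres is determined by $\alpha_1$ and $\dim(U\cap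 W)$: 1. $\alpha_1>1$ $\iff$ $U\cap W$ is euclidean $\iff$ $S_1,S_2$ are separable by hyperspheres; 2. $\alpha_1<1$ and $\dim(U\cap W)>1$ $\iff$ $U\cap W$ is pseudo-euclidean of dimension $\ge2$ $\iff$ $S_1\cap S_2$ is a $k$-sphere for some $k\ge0$; in this case it is a $k$-sphere with $k=m+l-n$; 3. $\alpha_1<1$ and $\dim(U\cap W)=1$ $\iff$ $U\cap W$ is pseudo-euclidean of dimension $1$ $\iff$ $S_1,S_2$ are interlaced; in this case $m+l=n-1$; 4. $\alpha_1=1$ $\iff$ $U\cap W$ is isotropic $\iff$ $S_1\cap S_2$ consists of exactly one point. Moreover, $\alpha_1<1$ if and only if $U\cap W$ is pseudo-euclidean, so that these four cases exhaust all pairs in general position. -/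

import Mathlib

open scoped LinearAlgebra.Projectivization Pointwise

noncomputable section

namespace Moebius

variable {V : Type*} [AddCommGroup V] [Module ℝ V]

/-- A pseudo-euclidean scalar product of index one: there is a basis whose Gram matrix is
`diag (1, …, 1, -1)`. Such a form is symmetric and non-degenerate. -/
def IsPseudoEuclidean (B : LinearMap.BilinForm ℝ V) : Prop :=
  ∃ (k : ℕ) (b : Module.Basis (Fin (k + 1)) ℝ V), ∀ i j,
    B (b i) (b j) = if i = j then (if i = Fin.last k then -1 else 1) else 0

/-- The restriction of the scalar product to `W` is positive definite (`W = 0` is allowed). -/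
def EuclideanOn (B : LinearMap.BilinForm ℝ V) (W : Submodule ℝ V) : Prop :=
  ∀ x ∈ W, x ≠ 0 → 0 < B x x

/-- The restriction of the scalar product to `W` is pseudo-euclidean of index one. -/
def PseudoEuclideanOn (B : LinearMap.BilinForm ℝ V) (W : Submodule ℝ V) : Prop :=
  IsPseudoEuclidean (B.restrict W)

/-- The restriction of the scalar product to `W` is degenerate, of rank `dim W - 1`. -/
def IsotropicOn (B : LinearMap.BilinForm ℝ V) (W : Submodule ℝ V) : Prop :=
  Module.finrank ℝ ↥(W ⊓ B.orthogonal W) = 1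

/-- The Möbius space: the set of the isotropic points of the projective space. -/
def quadric (B : LinearMap.BilinForm ℝ V) : Set (ℙ ℝ V) :=
  {p | ∀ x ∈ p.submodule, B x x = 0}

/-- The Möbius group: the projective transformations that preserve the Möbius space. -/
def moebiusGroup (B : LinearMap.BilinForm ℝ V) : Subgroup (Equiv.Perm (ℙ ℝ V)) :=
  (MulAction.toPermHom (V ≃ₗ[ℝ] V) (ℙ ℝ V)).range ⊓
    MulAction.stabilizer (Equiv.Perm (ℙ ℝ V)) (quadric B)

/-- An `m`-sphere, given by its pseudo-euclidean subspace of dimension `m + 2`. -/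
structure Subsphere (B : LinearMap.BilinForm ℝ V) (m : ℕ) where
  space : Submodule ℝ V
  pseudoEuclidean : PseudoEuclideanOn B space
  finrank_eq : Module.finrank ℝ space = m + 2

namespace Subsphere

variable {B : LinearMap.BilinForm ℝ V} {m l : ℕ}

/-- The points of the sphere. -/
def points (S : Subsphere B m) : Set (ℙ ℝ V) :=
  {p | p ∈ quadric B ∧ p.submodule ≤ S.space}

/-- The orthogonal complement of the subspace defining the sphere. -/
abbrev perp (S : Subsphere B m) : Submodule ℝ V := B.orthogonal S.space

theorem isCompl (S : Subsphere B m) : IsCompl S.perp S.space := by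
  obtain ⟨k, b, hb⟩ := S.pseudoEuclidean
  have hb' : ∀ i j, B (b i : V) (b j : V) =
      if i = j then (if i = Fin.last k then -1 else 1) else 0 := hb
  have key : ∀ v : V, (∀ i, B (b i : V) v = 0) → v ∈ S.perp := by
    intro v hv x hx
    have h : (B.flip v) ∘ₗ S.space.subtype = 0 := b.ext fun i => by simpa using hv i
    exact LinearMap.congr_fun h ⟨x, hx⟩
  refine ⟨Submodule.disjoint_def.2 fun x hx hxW => ?_, codisjoint_iff.2 ?_⟩
  · have h1 : ∀ i, b.repr ⟨x, hxW⟩ i = 0 := by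
      intro i
      have h2 : B (b i : V) x = 0 := hx _ (b i).2
      have h3 : x = ∑ j, b.repr ⟨x, hxW⟩ j • (b j : V) := by
        have h5 := congrArg S.space.subtype (b.sum_repr ⟨x, hxW⟩)
        rw [map_sum] at h5
        simp only [map_smul, Submodule.subtype_apply] at h5
        exact h5.symm
      rw [h3, map_sum] at h2
      simp only [map_smul, hb', smul_eq_mul, mul_ite, mul_zero, Finset.sum_ite_eq,
        Finset.mem_univ, if_true] at h2
      split_ifs at h2 <;> simpa using h2
    have h0 : (⟨x, hxW⟩ : S.space) = 0 := by
      apply b.repr.injective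
      ext i
      simpa using h1 i
    exact congrArg Subtype.val h0
  · refine eq_top_iff.2 fun v _ => ?_
    let w : V := ∑ j, ((if j = Fin.last k then (-1 : ℝ) else 1) * B (b j : V) v) • (b j : V)
    have hw : w ∈ S.space := Submodule.sum_mem _ fun j _ => Submodule.smul_mem _ _ (b j).2
    refine Submodule.mem_sup.2 ⟨v - w, key _ fun i => ?_, w, hw, by abel⟩
    have h4 : B (b i : V) w = B (b i : V) v := by
      simp only [w, map_sum, map_smul, hb', smul_eq_mul, mul_ite, mul_zero, Finset.sum_ite_eq,
        Finset.mem_univ, if_true]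
      split_ifs <;> ring
    rw [map_sub, h4, sub_self]

/-- The projection `S₁.perp → S₂.perp`: the restriction to `S₁.perp` of the projection of
`V = S₂.perp ⊕ S₂.space` onto `S₂.perp`. -/
def proj (S₁ : Subsphere B m) (S₂ : Subsphere B l) : S₁.perp →ₗ[ℝ] S₂.perp :=
  (S₂.perp.projectionOnto S₂.space S₂.isCompl) ∘ₗ S₁.perp.subtype

/-- The operator `A = p₁₂ ∘ p₂₁` on the orthogonal complement of the space of `S₁`. -/
def opA (S₁ : Subsphere B m) (S₂ : Subsphere B l) : Module.End ℝ S₁.perp :=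
  proj S₂ S₁ ∘ₗ proj S₁ S₂

/-- The eigenvalues of `A`, repeated by (algebraic) multiplicity and in decreasing order, numbered
from `0`, so that `eigenvalue S₁ S₂ 0` is the largest one. -/
def eigenvalue [FiniteDimensional ℝ V] (S₁ : Subsphere B m) (S₂ : Subsphere B l) (i : ℕ) : ℝ :=
  ((opA S₁ S₂).charpoly.roots.sort (· ≥ ·)).getD i 0

/-- In the `n`-dimensional Möbius space: no hypersphere contains both spheres. -/
def GeneralPosition (n : ℕ) (S₁ : Subsphere B m) (S₂ : Subsphere B l) : Prop :=
  ¬ ∃ H : Subsphere B (n - 1), S₁.points ∪ S₂.points ⊆ H.points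

/-- The sphere `S` lies on one side of the hypersphere `H`. Two isotropic vectors `x`, `y` with
`B x y < 0` belong to the same half of the light cone; the points `[x]`, `[y]` are then strictly
on different sides of the hypersphere with normal vector `v` iff `B v x` and `B v y` have
opposite signs. -/
def OnOneSide (H : Subsphere B m) (S : Subsphere B l) : Prop :=
  ∀ v ∈ H.perp, ∀ x ∈ S.space, ∀ y ∈ S.space, B x x = 0 → B y y = 0 → B x y < 0 →
    0 ≤ B v x * B v y

/-- In the `n`-dimensional Möbius space: there are disjoint hyperspheres `H₁ ⊇ S₁`, `H₂ ⊇ S₂`.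
For `n = 1`, where the hyperspheres are pairs of points and hence not connected, `H₂` has to lie
in one of the two arcs bounded by `H₁`. -/
def Separable (n : ℕ) (S₁ : Subsphere B m) (S₂ : Subsphere B l) : Prop :=
  ∃ H₁ H₂ : Subsphere B (n - 1), S₁.points ⊆ H₁.points ∧ S₂.points ⊆ H₂.points ∧
    H₁.points ∩ H₂.points = ∅ ∧ (n = 1 → OnOneSide H₁ H₂)

/-- The spheres are disjoint, but not separable by hyperspheres. -/
def Interlaced (n : ℕ) (S₁ : Subsphere B m) (S₂ : Subsphere B l) : Prop :=
  S₁.points ∩ S₂.points = ∅ ∧ ¬ Separable n S₁ S₂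

/-- Equivalence of pairs of spheres under the Möbius group. -/
def MoebiusEquivalent (S₁ : Subsphere B m) (S₂ : Subsphere B l)
    (T₁ : Subsphere B m) (T₂ : Subsphere B l) : Prop :=
  ∃ g ∈ moebiusGroup B, g '' S₁.points = T₁.points ∧ g '' S₂.points = T₂.points

end Subsphere

end Moebius

end

open Moebius Moebius.Subsphere

/-! Write `W`, `U` for the spaces of `S₁`, `S₂` and `p` for the projection of `W^⊥` to `U^⊥`. Both
complements are euclidean and the two projections are adjoint, so `⟨Ax, y⟩ = ⟨px, py⟩`: the spectral
theorem applies and the eigenvalues are non-negative.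

Everything on position comes from `u = x - px` with `x ∈ W^⊥`. It lies in `U`, is orthogonal to `U ∩
W`, and `⟨u, u⟩ = ⟨x, x⟩ - ⟨Ax, x⟩` (`apply_sub_proj_self`), which is `1 - α` for a unit
eigenvector. If `α₁ > 1`, `U ∩ W` is orthogonal to a timelike vector, hence euclidean. If `α₁ = 1`,
then `u` lies in `W` too and spans a radical, non-zero by general position. If `α₁ < 1`, the form is
positive on `W^⊥ + U^⊥ = (U ∩ W)^⊥`, so `U ∩ W` is pseudo-euclidean. These types exclude each other,
so trichotomy reverses the three implications. Counting null lines in `U ∩ W` gives the incidence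
statements; a timelike sum of normals of the two spheres gives separating hyperspheres.

For the invariants, an eigenbasis of `W^⊥`, its non-zero projections and an orthonormal completion
in `U^⊥` form an independent family whose Gram matrix depends only on the eigenvalues
(`exists_adapted_family`); Witt's theorem moves one such family to another. Conversely a Möbius
transformation comes from a linear map preserving the light cone, hence from a similarity, which
conjugates `A`. -/

namespace Moebius

/-! ### Spectral theorem on a euclidean space -/

section Euclidean

variable {E : Type*} [AddCommGroup E] [Module ℝ E] [FiniteDimensional ℝ E]

/-- The spectral theorem for a self-adjoint endomorphism with respect to a positive definite
symmetric bilinear form. -/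
theorem exists_orthonormal_eigenbasis (B : LinearMap.BilinForm ℝ E)
    (hs : ∀ x y, B x y = B y x) (hp : ∀ x, x ≠ 0 → 0 < B x x)
    (T : Module.End ℝ E) (hT : ∀ x y, B (T x) y = B x (T y))
    {N : ℕ} (hN : Module.finrank ℝ E = N) :
    ∃ (a : Module.Basis (Fin N) ℝ E) (α : Fin N → ℝ), Antitone α ∧
      (∀ i j, B (a i) (a j) = if i = j then 1 else 0) ∧ (∀ i, T (a i) = α i • a i) ∧
      T.charpoly.roots.sort (· ≥ ·) = List.ofFn α := by
  let core : InnerProductSpace.Core ℝ E :=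
    { inner := fun x y => B x y
      conj_inner_symm := fun x y => by simpa using hs y x
      re_inner_nonneg := fun x => by
        by_cases hx : x = 0
        · simp [hx]
        · simpa using (hp x hx).le
      add_left := fun x y z => by simp
      smul_left := fun x y r => by simp
      definite := fun x hx => by
        by_contra h
        exact (hp x h).ne' hx }
  -- The form itself becomes the inner product, so that symmetric operators in the usual sense are
  -- the self-adjoint ones.
  let : NormedAddCommGroup E := core.toNormedAddCommGroup
  let : InnerProductSpace ℝ E := InnerProductSpace.ofCore core.toCore
  have hTs : T.IsSymmetric := hT
  refine ⟨(hTs.eigenvectorBasis hN).toBasis, hTs.eigenvalues hN, hTs.eigenvalues_antitone hN,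
    fun i j => ?_, fun i => ?_, ?_⟩
  · have h := orthonormal_iff_ite.1 (hTs.eigenvectorBasis hN).orthonormal i j
    simp only [OrthonormalBasis.coe_toBasis]
    exact h
  · simp
  · simpa using hTs.sort_roots_charpoly_eq_eigenvalues hN

theorem exists_orthonormal_basis (B : LinearMap.BilinForm ℝ E)
    (hs : ∀ x y, B x y = B y x) (hp : ∀ x, x ≠ 0 → 0 < B x x)
    {N : ℕ} (hN : Module.finrank ℝ E = N) :
    ∃ a : Module.Basis (Fin N) ℝ E, ∀ i j, B (a i) (a j) = if i = j then 1 else 0 := by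
  obtain ⟨a, -, -, h, -⟩ := exists_orthonormal_eigenbasis B hs hp 0 (by simp) hN
  exact ⟨a, h⟩

end Euclidean

/-! ### Scalar products of index one and types of subspaces -/

variable {V : Type*} [AddCommGroup V] [Module ℝ V] {B : LinearMap.BilinForm ℝ V}

namespace IsPseudoEuclidean

theorem symm (hB : IsPseudoEuclidean B) (x y : V) : B x y = B y x := by
  obtain ⟨k, b, hb⟩ := hB
  have : B = B.flip := b.ext fun i => b.ext fun j => by
    change B (b i) (b j) = B (b j) (b i)
    rw [hb, hb]
    by_cases h : i = j
    · subst h; rfl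
    · simp [h, Ne.symm h]
  conv_lhs => rw [this]
  rfl

theorem exists_timelike_orthogonal_pos (hB : IsPseudoEuclidean B) :
    ∃ t, B t t < 0 ∧ ∀ x, B t x = 0 → x ≠ 0 → 0 < B x x := by
  obtain ⟨k, b, hb⟩ := hB
  refine ⟨b (Fin.last k), by rw [hb]; simp, fun x hx hx0 => ?_⟩
  have hrep : ∀ i, B (b i) x = b.repr x i * (if i = Fin.last k then -1 else 1) := by
    intro i
    conv_lhs => rw [← b.sum_repr x, map_sum]
    simp only [map_smul, hb, smul_eq_mul, mul_ite, mul_zero, Finset.sum_ite_eq,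
      Finset.mem_univ, if_true]
  have hlast : b.repr x (Fin.last k) = 0 := by
    have := hrep (Fin.last k)
    rw [hx] at this
    simpa using this.symm
  have hsq : B x x = ∑ i, b.repr x i ^ 2 := by
    have h1 : B x x = ∑ i, b.repr x i * B (b i) x := by
      conv_lhs => enter [1]; rw [← b.sum_repr x, map_sum]
      rw [LinearMap.sum_apply]
      simp only [map_smul, LinearMap.smul_apply, smul_eq_mul]
    rw [h1]
    refine Finset.sum_congr rfl fun i _ => ?_
    rw [hrep]
    by_cases h : i = Fin.last k
    · subst h; simp [hlast]
    · simp [h, sq]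
  rw [hsq]
  obtain ⟨i, hi⟩ : ∃ i, b.repr x i ≠ 0 := by
    by_contra! h
    exact hx0 (b.repr.map_eq_zero_iff.1 (Finsupp.ext h))
  exact Finset.sum_pos' (fun i _ => sq_nonneg _) ⟨i, Finset.mem_univ _, by positivity⟩

/-- A non-zero vector orthogonal to a timelike vector is spacelike. -/
theorem pos_of_orthogonal_timelike (hB : IsPseudoEuclidean B) {t x : V} (ht : B t t < 0)
    (htx : B t x = 0) (hx : x ≠ 0) : 0 < B x x := by
  obtain ⟨s, -, hs⟩ := hB.exists_timelike_orthogonal_pos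
  by_contra! hx'
  have hst : B s t ≠ 0 := fun h => by
    have := hs t h (by rintro rfl; simp at ht)
    linarith
  have hxt : B x t = 0 := by rw [hB.symm, htx]
  -- If `x` were not spacelike, the form would be negative semidefinite on the span of `t` and `x`;
  -- this combination lies in that span and in the positive definite complement of `s`.
  by_cases h0 : B s x • t - B s t • x = 0
  · have h1 : B t (B s x • t - B s t • x) = 0 := by rw [h0, map_zero]
    simp only [map_sub, map_smul, smul_eq_mul, htx, mul_zero, sub_zero] at h1
    have h2 : B s x = 0 := (mul_eq_zero.1 h1).resolve_right ht.ne
    rw [h2, zero_smul, zero_sub, neg_eq_zero] at h0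
    exact (smul_eq_zero.1 h0).elim hst hx
  · have h1 := hs _ (by simp only [map_sub, map_smul, smul_eq_mul]; ring) h0
    simp only [map_sub, map_smul, smul_eq_mul, LinearMap.sub_apply, LinearMap.smul_apply, htx,
      hxt] at h1
    nlinarith [mul_nonneg (sq_nonneg (B s x)) (neg_nonneg.2 ht.le),
      mul_nonneg (sq_nonneg (B s t)) (neg_nonneg.2 hx')]

/-- Orthogonal null vectors are proportional. -/
theorem exists_smul_eq_of_null (hB : IsPseudoEuclidean B) {x y : V} (hx : B x x = 0)
    (hy : B y y = 0) (hxy : B x y = 0) (hx0 : x ≠ 0) : ∃ c : ℝ, y = c • x := by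
  obtain ⟨s, -, hs⟩ := hB.exists_timelike_orthogonal_pos
  have hsx : B s x ≠ 0 := fun h => (hs x h hx0).ne' hx
  have hyx : B y x = 0 := by rw [hB.symm, hxy]
  -- The combination is null and orthogonal to `s`, whose complement is positive definite.
  have h0 : B s y • x - B s x • y = 0 := by
    by_contra h0
    have h1 := hs _ (by simp only [map_sub, map_smul, smul_eq_mul]; ring) h0
    simp [hxy, hx, hy, hyx] at h1
  refine ⟨B s y / B s x, ?_⟩
  rw [sub_eq_zero] at h0
  rw [div_eq_inv_mul, mul_smul, h0, smul_smul, inv_mul_cancel₀ hsx, one_smul]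

theorem isRefl (hB : IsPseudoEuclidean B) : B.IsRefl := fun x y h => by rw [hB.symm, h]

theorem nondegenerate (hB : IsPseudoEuclidean B) : B.Nondegenerate := by
  refine (LinearMap.IsRefl.nondegenerate_iff_separatingLeft hB.isRefl).2 fun x hx => ?_
  obtain ⟨t, ht, -⟩ := hB.exists_timelike_orthogonal_pos
  by_contra h
  have := hB.pos_of_orthogonal_timelike ht (by rw [hB.symm]; exact hx t) h
  rw [hx x] at this
  exact this.false

end IsPseudoEuclidean

theorem mem_orthogonal_inf_span (t x : V) (X : Submodule ℝ V) :
    x ∈ X ⊓ B.orthogonal (ℝ ∙ t) ↔ x ∈ X ∧ B t x = 0 := by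
  rw [Submodule.mem_inf, LinearMap.BilinForm.mem_orthogonal_iff]
  refine and_congr_right fun _ => ⟨fun h => h t (Submodule.mem_span_singleton_self t),
    fun h y hy => ?_⟩
  obtain ⟨c, rfl⟩ := Submodule.mem_span_singleton.1 hy
  simp [h]

theorem PseudoEuclideanOn.exists_timelike {X : Submodule ℝ V} (hX : PseudoEuclideanOn B X) :
    ∃ t ∈ X, B t t < 0 := by
  obtain ⟨t, ht, -⟩ := hX.exists_timelike_orthogonal_pos
  exact ⟨t, t.2, ht⟩

theorem exists_normalized_timelike {X : Submodule ℝ V} (h : ∃ t ∈ X, B t t < 0) :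
    ∃ t ∈ X, B t t = -1 := by
  obtain ⟨t, ht, htt⟩ := h
  refine ⟨(√(-B t t))⁻¹ • t, X.smul_mem _ ht, ?_⟩
  have h1 : √(-B t t) ^ 2 = -B t t := Real.sq_sqrt (by linarith)
  have h2 : √(-B t t) ≠ 0 := (Real.sqrt_pos.2 (by linarith)).ne'
  simp only [map_smul, LinearMap.smul_apply, smul_eq_mul]
  field_simp
  linarith

/-- A subspace that contains a timelike vector is pseudo-euclidean. -/
theorem IsPseudoEuclidean.pseudoEuclideanOn_of_timelike [FiniteDimensional ℝ V] (hB : IsPseudoEuclidean B)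
    {X : Submodule ℝ V} (h : ∃ t ∈ X, B t t < 0) : PseudoEuclideanOn B X := by
  obtain ⟨t, htX, ht⟩ := exists_normalized_timelike h
  -- `Y` is euclidean; an orthonormal basis of it followed by `t`, in the last place, has the
  -- required Gram matrix.
  let Y : Submodule ℝ V := X ⊓ B.orthogonal (ℝ ∙ t)
  have hY : ∀ y ∈ Y, y ∈ X ∧ B t y = 0 := fun y hy => (mem_orthogonal_inf_span t y X).1 hy
  obtain ⟨a, ha⟩ := exists_orthonormal_basis (B.restrict Y) (fun x y => hB.symm _ _)
    (fun x hx => hB.pos_of_orthogonal_timelike (by rw [ht]; norm_num) (hY x x.2).2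
      (by simpa using hx)) rfl
  have ha' : ∀ i j, B (a i : V) (a j : V) = if i = j then 1 else 0 := ha
  let e : Fin (Module.finrank ℝ Y + 1) → X :=
    Fin.snoc (α := fun _ => X) (fun i => ⟨a i, (hY _ (a i).2).1⟩) ⟨t, htX⟩
  have hel : e (Fin.last _) = ⟨t, htX⟩ := by simp [e]
  have hec : ∀ i, e (Fin.castSucc i) = ⟨a i, (hY _ (a i).2).1⟩ := fun i => by simp [e]
  have hgram : ∀ i j, B (e i : V) (e j : V) =
      if i = j then (if i = Fin.last _ then -1 else 1) else 0 := by
    intro i j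
    induction i using Fin.lastCases with
    | last =>
      induction j using Fin.lastCases with
      | last => simp [hel, ht]
      | cast j =>
        simp only [hel, hec, (hY _ (a j).2).2, (Fin.castSucc_lt_last j).ne', if_false]
    | cast i =>
      induction j using Fin.lastCases with
      | last =>
        rw [hel, hec, hB.symm]
        simp only [(hY _ (a i).2).2, (Fin.castSucc_lt_last i).ne, if_false]
      | cast j =>
        simp only [hec, ha', (Fin.castSucc_lt_last i).ne, if_false, Fin.castSucc_inj]
  have hli : LinearIndependent ℝ e := by
    refine LinearMap.BilinForm.linearIndependent_of_iIsOrtho (B := B.restrict X) ?_ ?_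
    · intro i j hij
      change B (e i : V) (e j : V) = 0
      rw [hgram, if_neg hij]
    · intro i hi
      change B (e i : V) (e i : V) = 0 at hi
      rw [hgram, if_pos rfl] at hi
      split_ifs at hi <;> norm_num at hi
  have hspan : ⊤ ≤ Submodule.span ℝ (Set.range e) := by
    rintro ⟨x, hx⟩ -
    have hxY : x + B t x • t ∈ Y := (mem_orthogonal_inf_span t _ X).2
      ⟨X.add_mem hx (X.smul_mem _ htX), by simp [ht]⟩
    have hmap : ∀ y (hy : y ∈ Y), (⟨y, (hY y hy).1⟩ : X) ∈ Submodule.span ℝ (Set.range e) := by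
      intro y hy
      have h1 : (⟨y, (hY y hy).1⟩ : X) = ∑ i, a.repr ⟨y, hy⟩ i • e (Fin.castSucc i) := by
        apply Subtype.ext
        have h2 := congrArg Y.subtype (a.sum_repr ⟨y, hy⟩)
        rw [map_sum] at h2
        simp only [map_smul, Submodule.subtype_apply] at h2
        simp only [hec, Submodule.coe_sum, Submodule.coe_smul, h2]
      rw [h1]
      exact Submodule.sum_mem _ fun i _ => Submodule.smul_mem _ _
        (Submodule.subset_span ⟨_, rfl⟩)
    have h3 : (⟨x, hx⟩ : X) = ⟨x + B t x • t, (hY _ hxY).1⟩ - B t x • e (Fin.last _) := by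
      apply Subtype.ext
      simp [hel]
    rw [h3]
    exact Submodule.sub_mem _ (hmap _ hxY) (Submodule.smul_mem _ _ (Submodule.subset_span ⟨_, rfl⟩))
  refine ⟨_, Module.Basis.mk hli hspan, fun i j => ?_⟩
  simp only [Module.Basis.mk_apply]
  exact hgram i j

theorem EuclideanOn.not_pseudoEuclideanOn {X : Submodule ℝ V} (h : EuclideanOn B X) :
    ¬ PseudoEuclideanOn B X := fun h' => by
  obtain ⟨t, ht, htt⟩ := h'.exists_timelike
  exact lt_asymm htt (h t ht (by rintro rfl; simp at htt))

theorem EuclideanOn.not_isotropicOn {X : Submodule ℝ V} (h : EuclideanOn B X) :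
    ¬ IsotropicOn B X := fun h' => by
  have : X ⊓ B.orthogonal X = ⊥ := (Submodule.eq_bot_iff _).2 fun x hx => by
    by_contra h0
    exact (h x hx.1 h0).ne' (hx.2 x hx.1)
  rw [IsotropicOn, this, finrank_bot] at h'
  norm_num at h'

theorem IsPseudoEuclidean.not_isotropicOn (hB : IsPseudoEuclidean B) {X : Submodule ℝ V}
    (h : PseudoEuclideanOn B X) : ¬ IsotropicOn B X := fun h' => by
  obtain ⟨t, ht, htt⟩ := h.exists_timelike
  have : X ⊓ B.orthogonal X = ⊥ := (Submodule.eq_bot_iff _).2 fun x hx => by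
    by_contra h0
    exact (hB.pos_of_orthogonal_timelike htt (hx.2 t ht) h0).ne' (hx.2 x hx.1)
  rw [IsotropicOn, this, finrank_bot] at h'
  norm_num at h'

/-- A subspace with a non-zero radical is isotropic. -/
theorem IsPseudoEuclidean.isotropicOn_of_mem_radical (hB : IsPseudoEuclidean B)
    {X : Submodule ℝ V} {r : V} (hr : r ∈ X) (hrX : r ∈ B.orthogonal X) (h0 : r ≠ 0) :
    IsotropicOn B X := by
  refine finrank_eq_one (⟨r, hr, hrX⟩ : ↥(X ⊓ B.orthogonal X)) 
    (fun h => h0 (congrArg Subtype.val h)) fun y => ?_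
  obtain ⟨c, hc⟩ := hB.exists_smul_eq_of_null (hrX r hr) (y.2.2 y y.2.1) (y.2.2 r hr) h0
  exact ⟨c, Subtype.ext hc.symm⟩

end Moebius

namespace Moebius

variable {V : Type*} [AddCommGroup V] [Module ℝ V] {B : LinearMap.BilinForm ℝ V}

/-! ### Witt's extension theorem -/

section Witt

/-- The orthogonal reflection in the complement of a non-null vector. -/
theorem exists_reflection (hs : ∀ x y, B x y = B y x) {u : V} (hu : B u u ≠ 0) :
    ∃ R : V ≃ₗ[ℝ] V, (∀ x y, B (R x) (R y) = B x y) ∧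
      ∀ x, R x = x - (2 * B u x / B u u) • u := by
  have h2 : ((2 / B u u) • B u : Module.Dual ℝ V) u = 2 := by
    simp only [LinearMap.smul_apply, smul_eq_mul]
    field_simp
  have hR : ∀ x, Module.reflection h2 x = x - (2 * B u x / B u u) • u := fun x => by
    rw [Module.reflection_apply, LinearMap.smul_apply, smul_eq_mul, div_mul_eq_mul_div]
  refine ⟨Module.reflection h2, fun x y => ?_, hR⟩
  simp only [hR, map_sub, map_smul, LinearMap.sub_apply, LinearMap.smul_apply, smul_eq_mul]
  rw [hs x u]
  field_simp
  ring

/-- Since `z` and `w` have the same norm, the reflection along `z - w` takes `z` to `w`; it fixes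
`X`, which is orthogonal to `z - w`. -/
theorem exists_isometry_map_eq_of_sub_not_null (hs : ∀ x y, B x y = B y x) {X : Submodule ℝ V}
    {z w : V} (hX : ∀ y ∈ X, B y z = B y w) (hzw : B z z = B w w)
    (hu : B (z - w) (z - w) ≠ 0) :
    ∃ R : V ≃ₗ[ℝ] V, (∀ x y, B (R x) (R y) = B x y) ∧ (∀ y ∈ X, R y = y) ∧ R z = w := by
  obtain ⟨R, hR, hRf⟩ := exists_reflection hs hu
  refine ⟨R, hR, fun y hy => ?_, ?_⟩
  · have : B (z - w) y = 0 := by rw [hs, map_sub, hX y hy, sub_self]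
    rw [hRf, this]; simp
  · have : 2 * B (z - w) z = B (z - w) (z - w) := by
      simp only [map_sub, LinearMap.sub_apply]
      rw [hs z w]
      linarith
    rw [hRf, this, div_self hu]; simp

namespace IsPseudoEuclidean

theorem exists_mem_orthogonal_apply_ne_zero [FiniteDimensional ℝ V] (hB : IsPseudoEuclidean B)
    {X : Submodule ℝ V} {z : V} (hz : z ∉ X) : ∃ v ∈ B.orthogonal X, B v z ≠ 0 := by
  by_contra! h
  apply hz
  rw [← LinearMap.BilinForm.orthogonal_orthogonal hB.nondegenerate hB.isRefl X]
  exact fun v hv => h v hv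

/-- The inductive step of Witt's theorem. When `z - w` is null, a preliminary reflection along some
`v ⟂ X` makes the difference non-null: its norm becomes `4⟨v, z⟩⟨v, w⟩ / ⟨v, v⟩`, so `v` must be
non-null and orthogonal to neither `z` nor `w`. -/
theorem exists_isometry_map_eq [FiniteDimensional ℝ V] (hB : IsPseudoEuclidean B)
    {X : Submodule ℝ V} {z w : V} (hz : z ∉ X) (hw : w ∉ X)
    (hX : ∀ y ∈ X, B y z = B y w) (hzw : B z z = B w w) :
    ∃ R : V ≃ₗ[ℝ] V, (∀ x y, B (R x) (R y) = B x y) ∧ (∀ y ∈ X, R y = y) ∧ R z = w := by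
  by_cases h0 : z - w = 0
  · exact ⟨LinearEquiv.refl ℝ V, fun _ _ => rfl, fun _ _ => rfl, sub_eq_zero.1 h0⟩
  by_cases hu : B (z - w) (z - w) = 0
  swap
  · exact exists_isometry_map_eq_of_sub_not_null hB.symm hX hzw hu
  have huz : B (z - w) z = 0 := by
    have := hu
    simp only [map_sub, LinearMap.sub_apply] at this ⊢
    rw [hB.symm z w] at this
    linarith
  have huw : B (z - w) w = 0 := by
    have := hu
    rw [map_sub, huz] at this
    linarith
  have huX : z - w ∈ B.orthogonal X := fun y hy => by
    change B y (z - w) = 0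
    rw [map_sub, hX y hy, sub_self]
  obtain ⟨v, hvX, hvz, hvw⟩ : ∃ v ∈ B.orthogonal X, B v z ≠ 0 ∧ B v w ≠ 0 := by
    obtain ⟨v₁, h₁, h₁z⟩ := hB.exists_mem_orthogonal_apply_ne_zero hz
    obtain ⟨v₂, h₂, h₂w⟩ := hB.exists_mem_orthogonal_apply_ne_zero hw
    by_cases h₁w : B v₁ w = 0
    · by_cases h₂z : B v₂ z = 0
      · exact ⟨v₁ + v₂, Submodule.add_mem _ h₁ h₂, by simpa [h₂z], by simpa [h₁w]⟩
      · exact ⟨v₂, h₂, h₂z, h₂w⟩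
    · exact ⟨v₁, h₁, h₁z, h₁w⟩
  obtain ⟨v, hvX, hvz, hvw, hv⟩ : ∃ v ∈ B.orthogonal X, B v z ≠ 0 ∧ B v w ≠ 0 ∧ B v v ≠ 0 := by
    -- Adding `z - w` keeps the products with `z` and `w`. If the sum were still null, `v` would be
    -- orthogonal, hence proportional, to `z - w`, and so orthogonal to `z`.
    by_cases hv : B v v = 0
    · refine ⟨v + (z - w), Submodule.add_mem _ hvX huX, ?_, ?_, fun h => ?_⟩
      · rwa [map_add, LinearMap.add_apply, huz, add_zero]
      · rwa [map_add, LinearMap.add_apply, huw, add_zero]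
      · have huv : B (z - w) v = 0 := by
          simp only [map_add, LinearMap.add_apply, hv, hu, hB.symm v (z - w)] at h
          linarith
        obtain ⟨c, rfl⟩ := hB.exists_smul_eq_of_null hu hv huv h0
        exact hvz (by rw [map_smul, LinearMap.smul_apply, huz, smul_zero])
    · exact ⟨v, hvX, hvz, hvw, hv⟩
  have hvX' : ∀ y ∈ X, B y v = 0 := fun y hy => hvX y hy
  obtain ⟨R, hR, hRf⟩ := exists_reflection hB.symm hv
  have hRX : ∀ y ∈ X, R y = y := fun y hy => by
    rw [hRf, hB.symm v y, hvX' y hy]; simp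
  obtain ⟨R', hR', hRX', hRz⟩ := exists_isometry_map_eq_of_sub_not_null (X := X) (z := R z) (w := w)
    hB.symm (fun y hy => by
      rw [← hX y hy, hRf, map_sub, map_smul, hvX' y hy, smul_zero, sub_zero])
    (by rw [hR, hzw]) (by
      have h1 : R z - w = (z - w) - (2 * B v z / B v v) • v := by rw [hRf]; abel
      have h2 : B (z - w) v = B v z - B v w := by rw [hB.symm, map_sub]
      have h3 : B (R z - w) (R z - w) = 4 * (B v z * B v w) / B v v := by
        rw [h1]
        simp only [map_sub (B _), map_sub B (z - w), LinearMap.sub_apply (B (z - w)), map_smul,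
          LinearMap.smul_apply, smul_eq_mul]
        rw [huz, huw, h2]
        field_simp
        ring
      rw [h3]
      positivity)
  refine ⟨R.trans R', fun x y => ?_, fun y hy => ?_, ?_⟩
  · simp [hR, hR']
  · simp [hRX y hy, hRX' y hy]
  · simpa using hRz

/-- Witt's extension theorem for a scalar product of index one. -/
theorem exists_isometry_extending [FiniteDimensional ℝ V] (hB : IsPseudoEuclidean B)
    {ι : Type*} [Finite ι] {x y : ι → V} (hx : LinearIndependent ℝ x)
    (hy : LinearIndependent ℝ y) (hxy : ∀ i j, B (x i) (x j) = B (y i) (y j)) :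
    ∃ R : V ≃ₗ[ℝ] V, (∀ u v, B (R u) (R v) = B u v) ∧ ∀ i, R (x i) = y i := by
  classical
  have := Fintype.ofFinite ι
  suffices h : ∀ s : Finset ι, ∃ R : V ≃ₗ[ℝ] V, (∀ u v, B (R u) (R v) = B u v) ∧
      ∀ i ∈ s, R (x i) = y i by
    obtain ⟨R, hR, hRx⟩ := h Finset.univ
    exact ⟨R, hR, fun i => hRx i (Finset.mem_univ i)⟩
  intro s
  induction s using Finset.induction_on with
  | empty => exact ⟨LinearEquiv.refl ℝ V, fun _ _ => rfl, by simp⟩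
  | insert a s ha ih =>
    obtain ⟨R, hR, hRx⟩ := ih
    have hRli : LinearIndependent ℝ (R ∘ x) := hx.map' R.toLinearMap R.ker
    have himage : (R ∘ x) '' s = y '' s := Set.image_congr fun i hi => hRx i hi
    -- The correction moves the next vector into place while fixing the span of the targets already
    -- reached.
    obtain ⟨R', hR', hRX, hRa⟩ := hB.exists_isometry_map_eq
      (X := Submodule.span ℝ (y '' s)) (z := R (x a)) (w := y a)
      (by rw [← himage]; exact hRli.notMem_span_image (by simpa using ha))
      (hy.notMem_span_image (by simpa using ha))
      (fun v hv => by
        induction hv using Submodule.span_induction with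
        | mem v hv =>
          obtain ⟨i, hi, rfl⟩ := hv
          rw [← hRx i hi, hR, hxy, hRx i hi]
        | zero => simp
        | add u v _ _ hu hv => simp [hu, hv]
        | smul c u _ hu => simp [hu])
      (by rw [hR, hxy])
    refine ⟨R.trans R', fun u v => by simp [hR, hR'], fun i hi => ?_⟩
    rcases Finset.mem_insert.1 hi with rfl | hi
    · simpa using hRa
    · rw [LinearEquiv.trans_apply, hRx i hi]
      exact hRX _ (Submodule.subset_span ⟨i, hi, rfl⟩)

end IsPseudoEuclidean

end Witt

/-! ### The light cone and orthogonal complements -/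

namespace IsPseudoEuclidean

/-- A symmetric form that vanishes on the light cone is a multiple of the scalar product. -/
theorem exists_eq_mul_of_null (hB : IsPseudoEuclidean B) {C : LinearMap.BilinForm ℝ V}
    (hC : ∀ x y, C x y = C y x) (h0 : ∀ x, B x x = 0 → C x x = 0) :
    ∃ c : ℝ, ∀ x y, C x y = c * B x y := by
  obtain ⟨t, -, ht⟩ := exists_normalized_timelike (B := B) (X := ⊤)
    (by obtain ⟨t, ht, -⟩ := hB.exists_timelike_orthogonal_pos; exact ⟨t, trivial, ht⟩)
  have hperp : ∀ e, B t e = 0 → C t e = 0 ∧ C e e = -C t t * B e e := by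
    intro e he
    by_cases he0 : e = 0
    · simp [he0]
    have hpos := hB.pos_of_orthogonal_timelike (by rw [ht]; norm_num) he he0
    set r := √(B e e) with hr
    have hr2 : r ^ 2 = B e e := Real.sq_sqrt hpos.le
    have hr0 : 0 < r := Real.sqrt_pos.2 hpos
    have he' : B e t = 0 := by rw [hB.symm, he]
    -- For `e ⟂ t` of norm `r²` both `r • t ± e` are null; the difference and the sum of the two
    -- equations give the two claims.
    have h1 := h0 (r • t + e) (by
      simp only [map_add, map_smul, LinearMap.add_apply, LinearMap.smul_apply, smul_eq_mul, he,
        he', ht]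
      linarith)
    have h2 := h0 (r • t - e) (by
      simp only [map_sub, map_smul, LinearMap.sub_apply, LinearMap.smul_apply, smul_eq_mul, he,
        he', ht]
      linarith)
    simp only [map_add, map_sub, map_smul, LinearMap.add_apply, LinearMap.sub_apply,
      LinearMap.smul_apply, smul_eq_mul, hC e t] at h1 h2
    refine ⟨(mul_eq_zero.1 (show r * C t e = 0 by linarith)).resolve_left hr0.ne', ?_⟩
    rw [← hr2]
    linarith
  have hquad : ∀ x, C x x = -C t t * B x x := by
    intro x
    have hp : B t (x + B t x • t) = 0 := by simp [ht]
    obtain ⟨h1, h2⟩ := hperp _ hp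
    simp only [map_add, map_smul, LinearMap.add_apply, LinearMap.smul_apply, smul_eq_mul] at h1 h2
    rw [hB.symm x t, ht] at h2
    rw [hC x t] at h2
    linear_combination h2 - 2 * B t x * h1
  refine ⟨-C t t, fun x y => ?_⟩
  have h := hquad (x + y)
  simp only [map_add, LinearMap.add_apply] at h
  rw [hquad x, hquad y, hC y x, hB.symm y x] at h
  linarith

/-- If the orthogonal complement of a subspace is euclidean, the subspace is pseudo-euclidean. -/
theorem pseudoEuclideanOn_of_orthogonal [FiniteDimensional ℝ V] (hB : IsPseudoEuclidean B)
    {X : Submodule ℝ V} (h : EuclideanOn B (B.orthogonal X)) : PseudoEuclideanOn B X := by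
  have hdis : Disjoint X (B.orthogonal X) := Submodule.disjoint_def.2 fun x hx hx' => by
    by_contra h0
    exact (h x hx' h0).ne' (hx' x hx)
  have hc := (LinearMap.BilinForm.isCompl_orthogonal_iff_disjoint hB.isRefl).2 hdis
  obtain ⟨t, ht, -⟩ := hB.exists_timelike_orthogonal_pos
  obtain ⟨x, hx, y, hy, rfl⟩ := Submodule.mem_sup.1
    (hc.sup_eq_top ▸ Submodule.mem_top : t ∈ X ⊔ B.orthogonal X)
  refine hB.pseudoEuclideanOn_of_timelike ⟨x, hx, ?_⟩
  have h1 : B x y = 0 := hy x hx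
  have h2 : B y x = 0 := by rw [hB.symm, h1]
  have h3 : 0 ≤ B y y := by
    by_cases h0 : y = 0
    · simp [h0]
    · exact (h y hy h0).le
  simp only [map_add, LinearMap.add_apply, h1, h2] at ht
  linarith

theorem euclideanOn_of_timelike_orthogonal (hB : IsPseudoEuclidean B) {X : Submodule ℝ V} {t : V}
    (ht : B t t < 0) (htX : ∀ x ∈ X, B t x = 0) : EuclideanOn B X :=
  fun x hx hx0 => hB.pos_of_orthogonal_timelike ht (htX x hx) hx0

theorem orthogonal_inf [FiniteDimensional ℝ V] (hB : IsPseudoEuclidean B) (X Y : Submodule ℝ V) :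
    B.orthogonal (X ⊓ Y) = B.orthogonal X ⊔ B.orthogonal Y := by
  have hXY : B.orthogonal (B.orthogonal X ⊔ B.orthogonal Y) = X ⊓ Y := by
    apply le_antisymm
    · refine le_inf ?_ ?_
      · conv_rhs => rw [← LinearMap.BilinForm.orthogonal_orthogonal hB.nondegenerate hB.isRefl X]
        exact LinearMap.BilinForm.orthogonal_le le_sup_left
      · conv_rhs => rw [← LinearMap.BilinForm.orthogonal_orthogonal hB.nondegenerate hB.isRefl Y]
        exact LinearMap.BilinForm.orthogonal_le le_sup_right
    · rintro x ⟨hx, hy⟩ v hv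
      obtain ⟨a, ha, b, hb, rfl⟩ := Submodule.mem_sup.1 hv
      have h1 : B x a = 0 := ha x hx
      have h2 : B x b = 0 := hb x hy
      change B (a + b) x = 0
      rw [hB.symm, map_add, h1, h2, add_zero]
  rw [← hXY, LinearMap.BilinForm.orthogonal_orthogonal hB.nondegenerate hB.isRefl]

/-- Null vectors in the same half of the light cone lie on the same side of a timelike vector. -/
theorem mul_apply_nonneg_of_null (hB : IsPseudoEuclidean B) {t x y : V} (ht : B t t < 0)
    (hx : B x x = 0) (hy : B y y = 0) (hxy : B x y < 0) : 0 ≤ B t x * B t y := by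
  by_contra! h
  -- Were the product negative, this vector orthogonal to `t` would have negative norm.
  have hw : B t (B t y • x - B t x • y) = 0 := by
    simp only [map_sub, map_smul, smul_eq_mul]; ring
  have hq : B (B t y • x - B t x • y) (B t y • x - B t x • y) = -2 * (B t x * B t y) * B x y := by
    simp only [map_sub, map_smul, LinearMap.sub_apply, LinearMap.smul_apply, smul_eq_mul, hx, hy,
      hB.symm y x]
    ring
  by_cases h0 : B t y • x - B t x • y = 0
  · rw [h0] at hq
    simp only [map_zero] at hq
    nlinarith [mul_pos_of_neg_of_neg h hxy]
  · have := hB.pos_of_orthogonal_timelike ht hw h0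
    rw [hq] at this
    nlinarith [mul_pos_of_neg_of_neg h hxy]

end IsPseudoEuclidean

end Moebius

/-! ### Spheres, their subspaces and general position -/

namespace Moebius

variable {V : Type*} [AddCommGroup V] [Module ℝ V] {B : LinearMap.BilinForm ℝ V}

theorem mk_mem_quadric {v : V} (hv : v ≠ 0) :
    Projectivization.mk ℝ v hv ∈ quadric B ↔ B v v = 0 := by
  simp only [quadric, Set.mem_ofPred_eq, Projectivization.submodule_mk]
  refine ⟨fun h => h v (Submodule.mem_span_singleton_self v), fun h x hx => ?_⟩
  obtain ⟨c, rfl⟩ := Submodule.mem_span_singleton.1 hx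
  simp [h]

theorem linearEquiv_smul_mk (F : V ≃ₗ[ℝ] V) {v : V} (hv : v ≠ 0) :
    MulAction.toPermHom (V ≃ₗ[ℝ] V) (ℙ ℝ V) F (Projectivization.mk ℝ v hv) =
      Projectivization.mk ℝ (F v) (F.map_ne_zero_iff.2 hv) :=
  rfl

/-- A timelike vector of a subspace of dimension at least two has an orthogonal spacelike vector of
opposite norm in that subspace. -/
theorem IsPseudoEuclidean.exists_orthogonal_spacelike [FiniteDimensional ℝ V]
    (hB : IsPseudoEuclidean B) (X : Submodule ℝ V)
    (hX : 2 ≤ Module.finrank ℝ X) {t : V} (ht : t ∈ X) (htt : B t t < 0) :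
    ∃ s ∈ X, B t s = 0 ∧ B s s = -B t t := by
  obtain ⟨s, hs, hs0⟩ : ∃ s ∈ X ⊓ B.orthogonal (ℝ ∙ t), s ≠ 0 := by
    by_contra! h
    have hle : X ≤ ℝ ∙ t := fun x hx => by
      have h1 : x - (B t x / B t t) • t = 0 := h _ ((mem_orthogonal_inf_span t _ X).2
        ⟨X.sub_mem hx (X.smul_mem _ ht), by
          simp only [map_sub, map_smul, smul_eq_mul]
          rw [div_mul_cancel₀ _ htt.ne, sub_self]⟩)
      exact Submodule.mem_span_singleton.2 ⟨_, (sub_eq_zero.1 h1).symm⟩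
    have := Submodule.finrank_mono hle
    rw [finrank_span_singleton (by rintro rfl; simp at htt)] at this
    omega
  obtain ⟨hsX, hts⟩ := (mem_orthogonal_inf_span t s X).1 hs
  have hpos := hB.pos_of_orthogonal_timelike htt hts hs0
  have h1 : 0 ≤ -B t t / B s s := div_nonneg (by linarith) hpos.le
  refine ⟨√(-B t t / B s s) • s, X.smul_mem _ hsX, by simp [hts], ?_⟩
  simp only [map_smul, LinearMap.smul_apply, smul_eq_mul]
  rw [← mul_assoc, Real.mul_self_sqrt h1, div_mul_cancel₀ _ hpos.ne']

namespace Subsphere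

variable {m l k : ℕ}

theorem mk_mem_points {S : Subsphere B m} {v : V} (hv : v ≠ 0) :
    Projectivization.mk ℝ v hv ∈ S.points ↔ B v v = 0 ∧ v ∈ S.space := by
  simp only [points, Set.mem_ofPred_eq, mk_mem_quadric, Projectivization.submodule_mk,
    Submodule.span_singleton_le_iff_mem]

theorem points_subset_of_space_le {S : Subsphere B m} {T : Subsphere B l}
    (h : S.space ≤ T.space) : S.points ⊆ T.points := fun _ hp => ⟨hp.1, hp.2.trans h⟩

theorem perp_euclideanOn (hB : IsPseudoEuclidean B) (S : Subsphere B m) :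
    EuclideanOn B S.perp := by
  obtain ⟨t, ht, htt⟩ := S.pseudoEuclidean.exists_timelike
  exact hB.euclideanOn_of_timelike_orthogonal htt fun x hx => hx t ht

variable [FiniteDimensional ℝ V]

/-- The space of a sphere is spanned by its null vectors. -/
theorem space_le_of_null_mem (hB : IsPseudoEuclidean B) (S : Subsphere B m) {X : Submodule ℝ V}
    (hX : ∀ x ∈ S.space, B x x = 0 → x ∈ X) : S.space ≤ X := by
  obtain ⟨t, ht, htt⟩ := S.pseudoEuclidean.exists_timelike
  -- Here `t + s` and `t - s` are null, and they span `t` and `s`. Rescaling brings any non-zero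
  -- vector orthogonal to `t` to this norm.
  have hboth : ∀ s ∈ S.space, B t s = 0 → B s s = -B t t → t ∈ X ∧ s ∈ X := by
    intro s hs hts hss
    have hst : B s t = 0 := by rw [hB.symm, hts]
    have h1 := hX (t + s) (S.space.add_mem ht hs) (by simp [hts, hst, hss])
    have h2 := hX (t - s) (S.space.sub_mem ht hs) (by simp [hts, hst, hss])
    have h3 : t = (1 / 2 : ℝ) • ((t + s) + (t - s)) := by module
    have h4 : s = (1 / 2 : ℝ) • ((t + s) - (t - s)) := by module
    constructor
    · rw [h3]; exact X.smul_mem _ (X.add_mem h1 h2)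
    · rw [h4]; exact X.smul_mem _ (X.sub_mem h1 h2)
  have htX : t ∈ X := by
    obtain ⟨s, hs, hts, hss⟩ := hB.exists_orthogonal_spacelike S.space
      (by rw [S.finrank_eq]; omega) ht htt
    exact (hboth s hs hts hss).1
  have hperp : ∀ s ∈ S.space, B t s = 0 → s ∈ X := by
    intro s hs hts
    by_cases hs0 : s = 0
    · rw [hs0]; exact X.zero_mem
    have hpos := hB.pos_of_orthogonal_timelike htt hts hs0
    have h1 : 0 < -B t t / B s s := div_pos (by linarith) hpos
    have h2 := (hboth (√(-B t t / B s s) • s) (S.space.smul_mem _ hs) (by simp [hts]) (by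
      simp only [map_smul, LinearMap.smul_apply, smul_eq_mul]
      rw [← mul_assoc, Real.mul_self_sqrt h1.le, div_mul_cancel₀ _ hpos.ne'])).2
    exact (Submodule.smul_mem_iff _ (Real.sqrt_pos.2 h1).ne').1 h2
  intro x hx
  have h1 := hperp (x - (B t x / B t t) • t) (S.space.sub_mem hx (S.space.smul_mem _ ht)) (by
    simp only [map_sub, map_smul, smul_eq_mul]
    rw [div_mul_cancel₀ _ htt.ne, sub_self])
  simpa using X.add_mem h1 (X.smul_mem (B t x / B t t) htX)

theorem space_le_of_points_subset (hB : IsPseudoEuclidean B) {S : Subsphere B m}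
    {T : Subsphere B l} (h : S.points ⊆ T.points) : S.space ≤ T.space :=
  space_le_of_null_mem hB S fun x hx hxx => by
    by_cases h0 : x = 0
    · rw [h0]; exact T.space.zero_mem
    · exact ((mk_mem_points h0).1 (h ((mk_mem_points h0).2 ⟨hxx, hx⟩))).2

/-- A sphere has at least two points. -/
theorem exists_ne_mem_points (hB : IsPseudoEuclidean B) (S : Subsphere B m) :
    ∃ p ∈ S.points, ∃ q ∈ S.points, p ≠ q := by
  obtain ⟨t, ht, htt⟩ := S.pseudoEuclidean.exists_timelike
  obtain ⟨s, hs, hts, hss⟩ := hB.exists_orthogonal_spacelike S.space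
    (by rw [S.finrank_eq]; omega) ht htt
  have hst : B s t = 0 := by rw [hB.symm, hts]
  have h1 : B t (t + s) ≠ 0 := by simpa [hts] using htt.ne
  have h2 : B t (t - s) ≠ 0 := by simpa [hts] using htt.ne
  have h1' : t + s ≠ 0 := fun h => h1 (by rw [h, map_zero])
  have h2' : t - s ≠ 0 := fun h => h2 (by rw [h, map_zero])
  refine ⟨Projectivization.mk ℝ (t + s) h1', (mk_mem_points _).2
    ⟨by simp [hts, hst, hss], S.space.add_mem ht hs⟩, Projectivization.mk ℝ (t - s) h2',
    (mk_mem_points _).2 ⟨by simp [hts, hst, hss], S.space.sub_mem ht hs⟩, fun h => ?_⟩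
  obtain ⟨c, hc⟩ := (Projectivization.mk_eq_mk_iff' ℝ _ _ h1' h2').1 h
  have h3 := congrArg (B t) hc
  have h4 := congrArg (B s) hc
  simp only [map_smul, map_add, map_sub, smul_eq_mul, hts, hst, hss] at h3 h4
  have h5 : c = 1 := by
    have : (c - 1) * B t t = 0 := by linarith
    linarith [(mul_eq_zero.1 this).resolve_right htt.ne]
  subst h5
  linarith

theorem orthogonal_perp (hB : IsPseudoEuclidean B) (S : Subsphere B m) :
    B.orthogonal S.perp = S.space :=
  LinearMap.BilinForm.orthogonal_orthogonal hB.nondegenerate hB.isRefl _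

theorem finrank_perp (hB : IsPseudoEuclidean B) (S : Subsphere B m) {n : ℕ}
    (hV : Module.finrank ℝ V = n + 2) : Module.finrank ℝ S.perp = n - m := by
  rw [LinearMap.BilinForm.finrank_orthogonal hB.nondegenerate, S.finrank_eq, hV]
  omega

/-- The hypersphere with a given normal vector in the complement of a sphere. -/
theorem exists_hypersphere (hB : IsPseudoEuclidean B) (S : Subsphere B m) {n : ℕ} (hn : 1 ≤ n)
    (hV : Module.finrank ℝ V = n + 2) {v : V} (hv : v ∈ S.perp) (hv0 : v ≠ 0) :
    ∃ H : Subsphere B (n - 1), H.space = B.orthogonal (ℝ ∙ v) ∧ S.space ≤ H.space := by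
  have hle : S.space ≤ B.orthogonal (ℝ ∙ v) := fun x hx => by
    have := (mem_orthogonal_inf_span (B := B) v x ⊤).2
      ⟨trivial, by rw [hB.symm]; exact hv x hx⟩
    exact this.2
  obtain ⟨t, ht, htt⟩ := S.pseudoEuclidean.exists_timelike
  refine ⟨⟨B.orthogonal (ℝ ∙ v), hB.pseudoEuclideanOn_of_timelike ⟨t, hle ht, htt⟩, ?_⟩, rfl, hle⟩
  rw [LinearMap.BilinForm.finrank_orthogonal hB.nondegenerate, finrank_span_singleton hv0, hV]
  omega

/-- In general position, the orthogonal complements meet only in zero. -/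
theorem GeneralPosition.perp_inf_perp (hB : IsPseudoEuclidean B) {n : ℕ} (hn : 1 ≤ n)
    (hV : Module.finrank ℝ V = n + 2) {S₁ : Subsphere B m} {S₂ : Subsphere B l}
    (h : GeneralPosition n S₁ S₂) : S₁.perp ⊓ S₂.perp = ⊥ := by
  refine (Submodule.eq_bot_iff _).2 fun v hv => ?_
  by_contra h0
  -- A common normal vector defines one hypersphere through both spheres.
  obtain ⟨H, hH, hle⟩ := S₁.exists_hypersphere hB hn hV hv.1 h0
  obtain ⟨H', hH', hle'⟩ := S₂.exists_hypersphere hB hn hV hv.2 h0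
  refine h ⟨H, Set.union_subset (points_subset_of_space_le hle)
    (points_subset_of_space_le (hle'.trans ?_))⟩
  rw [hH, hH']

/-- General position amounts to `U + W = V`, the complement of `U^⊥ ∩ W^⊥ = 0`; the rest is the
dimension formula, stated additively to avoid truncated subtraction. -/
theorem GeneralPosition.finrank_inf (hB : IsPseudoEuclidean B) {n : ℕ} (hn : 1 ≤ n)
    (hV : Module.finrank ℝ V = n + 2) {S₁ : Subsphere B m} {S₂ : Subsphere B l}
    (h : GeneralPosition n S₁ S₂) :
    Module.finrank ℝ ↥(S₂.space ⊓ S₁.space) + n = m + l + 2 := by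
  have h1 : S₂.space ⊔ S₁.space = ⊤ := by
    have h2 := hB.orthogonal_inf S₂.perp S₁.perp
    rw [orthogonal_perp hB, orthogonal_perp hB, inf_comm, h.perp_inf_perp hB hn hV,
      LinearMap.BilinForm.orthogonal_bot] at h2
    exact h2.symm
  have h3 := Submodule.finrank_sup_add_finrank_inf_eq S₂.space S₁.space
  rw [h1, finrank_top, hV, S₁.finrank_eq, S₂.finrank_eq] at h3
  omega

end Subsphere

end Moebius

/-! ### The operator `A` and its eigenvalues -/

namespace Moebius

namespace Subsphere

variable {V : Type*} [AddCommGroup V] [Module ℝ V] {B : LinearMap.BilinForm ℝ V} {m l : ℕ}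

theorem sub_proj_mem (S₁ : Subsphere B m) (S₂ : Subsphere B l) (x : S₁.perp) :
    (x : V) - proj S₁ S₂ x ∈ S₂.space := by
  have h : S₂.perp.projectionOnto S₂.space S₂.isCompl ((x : V) - proj S₁ S₂ x) = 0 := by
    rw [map_sub, Submodule.projectionOnto_apply_left]
    exact sub_self _
  exact (Submodule.projectionOnto_apply_eq_zero_iff S₂.isCompl).1 h

theorem proj_eq_of_sub_mem {S₁ : Subsphere B m} {S₂ : Subsphere B l} {x : S₁.perp} {y : S₂.perp}
    (h : (x : V) - y ∈ S₂.space) : proj S₁ S₂ x = y := by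
  have h1 := (Submodule.projectionOnto_apply_eq_zero_iff S₂.isCompl).2 h
  rw [map_sub, Submodule.projectionOnto_apply_left, sub_eq_zero] at h1
  exact h1

/-- The projection is adjoint to the inclusion. -/
theorem apply_proj (S₁ : Subsphere B m) (S₂ : Subsphere B l) (x : S₁.perp) (y : S₂.perp) :
    B (proj S₁ S₂ x) y = B (x : V) y := by
  have h : B ((x : V) - proj S₁ S₂ x) y = 0 := y.2 _ (sub_proj_mem S₁ S₂ x)
  rw [map_sub, LinearMap.sub_apply] at h
  linarith

/-- The two projections are adjoint to each other, so `A` is the pull-back of the form on `U^⊥`;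
self-adjointness and non-negativity follow. -/
theorem apply_opA (hB : IsPseudoEuclidean B) (S₁ : Subsphere B m) (S₂ : Subsphere B l)
    (x y : S₁.perp) : B (opA S₁ S₂ x) y = B (proj S₁ S₂ x) (proj S₁ S₂ y) := by
  have h1 : B (opA S₁ S₂ x) y = B (proj S₁ S₂ x : V) y := apply_proj S₂ S₁ _ y
  rw [h1, hB.symm, ← apply_proj, hB.symm]

theorem opA_selfAdjoint (hB : IsPseudoEuclidean B) (S₁ : Subsphere B m) (S₂ : Subsphere B l)
    (x y : S₁.perp) : B (opA S₁ S₂ x) y = B x (opA S₁ S₂ y) := by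
  rw [apply_opA hB, hB.symm, ← apply_opA hB, hB.symm]

theorem sub_proj_orthogonal (hB : IsPseudoEuclidean B) {S₁ : Subsphere B m}
    {S₂ : Subsphere B l} (x : S₁.perp) {y : V}
    (hy : y ∈ S₂.space ⊓ S₁.space) : B ((x : V) - proj S₁ S₂ x) y = 0 := by
  have h1 : B y x = 0 := x.2 y hy.2
  have h2 : B y (proj S₁ S₂ x) = 0 := (proj S₁ S₂ x).2 y hy.1
  rw [hB.symm, map_sub, h1, h2, sub_zero]

/-- Pythagoras for `V = U ⊕ U^⊥`. On a unit eigenvector the value is `1 - α`, so the eigenvalue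
decides whether this vector of `U` is timelike, null or spacelike. -/
theorem apply_sub_proj_self (hB : IsPseudoEuclidean B) {S₁ : Subsphere B m}
    {S₂ : Subsphere B l} (x : S₁.perp) :
    B ((x : V) - proj S₁ S₂ x) ((x : V) - proj S₁ S₂ x) =
      B (x : V) x - B (opA S₁ S₂ x) x := by
  have h1 := apply_proj S₁ S₂ x (proj S₁ S₂ x)
  rw [apply_opA hB]
  simp only [map_sub, LinearMap.sub_apply]
  rw [hB.symm (proj S₁ S₂ x : V) x, h1]
  ring

variable [FiniteDimensional ℝ V]

theorem exists_eigenbasis (hB : IsPseudoEuclidean B) (S₁ : Subsphere B m) (S₂ : Subsphere B l)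
    {n : ℕ} (hV : Module.finrank ℝ V = n + 2) :
    (∃ a : Module.Basis (Fin (n - m)) ℝ S₁.perp,
      (∀ i j, B (a i) (a j) = if i = j then 1 else 0) ∧
      ∀ i : Fin (n - m), opA S₁ S₂ (a i) = eigenvalue S₁ S₂ i • a i) ∧
    (∀ i j : ℕ, i ≤ j → j < n - m → eigenvalue S₁ S₂ j ≤ eigenvalue S₁ S₂ i) ∧
    ∀ i < n - m, 0 ≤ eigenvalue S₁ S₂ i := by
  obtain ⟨a, α, hα, ha, haα, hsort⟩ := exists_orthonormal_eigenbasis (B.restrict S₁.perp)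
    (fun x y => hB.symm _ _) (fun x hx => S₁.perp_euclideanOn hB x x.2 (by simpa using hx))
    (opA S₁ S₂) (opA_selfAdjoint hB S₁ S₂) (S₁.finrank_perp hB hV)
  have ha' : ∀ i j, B (a i) (a j) = if i = j then 1 else 0 := ha
  -- The sorted list has length `n - m`, so the default value `0` is not reached.
  have heig : ∀ i (hi : i < n - m), eigenvalue S₁ S₂ i = α ⟨i, hi⟩ := by
    intro i hi
    simp only [eigenvalue, hsort]
    rw [List.getD_eq_getElem _ _ (by simpa using hi), List.getElem_ofFn]
  refine ⟨⟨a, ha', fun i => by rw [haα, heig i i.2]⟩, fun i j hij hj => ?_, fun i hi => ?_⟩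
  · rw [heig i (by omega), heig j hj]
    exact hα hij
  · have h1 := apply_opA hB S₁ S₂ (a ⟨i, hi⟩) (a ⟨i, hi⟩)
    rw [haα, Submodule.coe_smul, map_smul, LinearMap.smul_apply, ha', if_pos rfl, smul_eq_mul,
      mul_one] at h1
    rw [heig i hi, h1]
    by_cases h0 : (proj S₁ S₂ (a ⟨i, hi⟩) : V) = 0
    · rw [h0]; simp
    · exact (S₂.perp_euclideanOn hB _ (proj S₁ S₂ (a ⟨i, hi⟩)).2 h0).le

/-! ### The type of `U ∩ W` from the largest eigenvalue -/

section Position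

variable {n : ℕ} {S₁ : Subsphere B m} {S₂ : Subsphere B l}

theorem euclideanOn_of_one_lt_eigenvalue (hB : IsPseudoEuclidean B) (hmn : m < n)
    (hV : Module.finrank ℝ V = n + 2) (h : 1 < eigenvalue S₁ S₂ 0) :
    EuclideanOn B (S₂.space ⊓ S₁.space) := by
  obtain ⟨⟨a, ha, haα⟩, -, -⟩ := exists_eigenbasis hB S₁ S₂ hV
  let i : Fin (n - m) := ⟨0, by omega⟩
  refine hB.euclideanOn_of_timelike_orthogonal (t := (a i : V) - proj S₁ S₂ (a i)) ?_
    fun y hy => sub_proj_orthogonal hB _ hy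
  rw [apply_sub_proj_self hB, haα, Submodule.coe_smul, map_smul, LinearMap.smul_apply, ha]
  simp only [if_true, smul_eq_mul, mul_one]
  change 1 - eigenvalue S₁ S₂ 0 < 0
  linarith

/-- If `Ax = x`, then `x - px` also lies in `W`, since projecting `px` back gives `x`. It is
orthogonal to `U ∩ W`, hence in the radical; it vanishes only if `x ∈ W^⊥ ∩ U^⊥`. -/
theorem isotropicOn_of_eigenvalue_eq_one (hB : IsPseudoEuclidean B) (hmn : m < n)
    (hV : Module.finrank ℝ V = n + 2) (hS : S₁.perp ⊓ S₂.perp = ⊥)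
    (h : eigenvalue S₁ S₂ 0 = 1) : IsotropicOn B (S₂.space ⊓ S₁.space) := by
  obtain ⟨⟨a, ha, haα⟩, -, -⟩ := exists_eigenbasis hB S₁ S₂ hV
  let i : Fin (n - m) := ⟨0, by omega⟩
  have hA : opA S₁ S₂ (a i) = a i := by
    rw [haα]
    change eigenvalue S₁ S₂ 0 • a i = a i
    rw [h, one_smul]
  refine hB.isotropicOn_of_mem_radical (r := (a i : V) - proj S₁ S₂ (a i))
    ⟨sub_proj_mem _ _ _, ?_⟩ (fun y hy => ?_) fun h0 => ?_
  · have h1 := sub_proj_mem S₂ S₁ (proj S₁ S₂ (a i))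
    have h2 : proj S₂ S₁ (proj S₁ S₂ (a i)) = a i := hA
    rw [h2] at h1
    simpa using S₁.space.neg_mem h1
  · change B y _ = 0
    rw [hB.symm, sub_proj_orthogonal hB _ hy]
  · have h1 : (a i : V) ∈ S₁.perp ⊓ S₂.perp :=
      ⟨(a i).2, by rw [sub_eq_zero.1 h0]; exact (proj S₁ S₂ (a i)).2⟩
    rw [hS, Submodule.mem_bot] at h1
    exact a.ne_zero i (Subtype.ext h1)

/-- Every `1 - αᵢ` is positive, so `x - px` is spacelike for all `x ≠ 0` in `W^⊥`, and this makes
`W^⊥ + U^⊥` euclidean. -/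
theorem pseudoEuclideanOn_of_eigenvalue_lt_one (hB : IsPseudoEuclidean B)
    (hV : Module.finrank ℝ V = n + 2)
    (h : eigenvalue S₁ S₂ 0 < 1) : PseudoEuclideanOn B (S₂.space ⊓ S₁.space) := by
  obtain ⟨⟨a, ha, haα⟩, hanti, -⟩ := exists_eigenbasis hB S₁ S₂ hV
  have hquad : ∀ x : S₁.perp, x ≠ 0 →
      0 < B ((x : V) - proj S₁ S₂ x) ((x : V) - proj S₁ S₂ x) := by
    intro x hx
    have hcoe : (x : V) = ∑ i, a.repr x i • (a i : V) := by
      have h1 := congrArg S₁.perp.subtype (a.sum_repr x)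
      rw [map_sum] at h1
      simp only [map_smul, Submodule.subtype_apply] at h1
      exact h1.symm
    have hx1 : ∀ i, B (a i : V) x = a.repr x i := by
      intro i
      rw [hcoe, map_sum]
      simp [ha]
    have hsum : ∀ y : V, B (x : V) y = ∑ i, a.repr x i * B (a i : V) y := by
      intro y
      conv_lhs => enter [1]; rw [hcoe, map_sum]
      simp
    have h1 : B (x : V) x - B (opA S₁ S₂ x) x =
        ∑ i : Fin (n - m), (1 - eigenvalue S₁ S₂ i) * a.repr x i ^ 2 := by
      rw [opA_selfAdjoint hB, hsum, hsum, ← Finset.sum_sub_distrib]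
      refine Finset.sum_congr rfl fun i _ => ?_
      rw [← opA_selfAdjoint hB, haα, Submodule.coe_smul, map_smul, LinearMap.smul_apply, hx1,
        smul_eq_mul]
      ring
    rw [apply_sub_proj_self hB, h1]
    have hlt : ∀ i : Fin (n - m), 0 < 1 - eigenvalue S₁ S₂ i := fun i => by
      have := hanti 0 i (Nat.zero_le _) i.2
      linarith
    obtain ⟨i, hi⟩ : ∃ i, a.repr x i ≠ 0 := by
      by_contra! h
      exact hx (a.repr.map_eq_zero_iff.1 (Finsupp.ext h))
    exact Finset.sum_pos' (fun i _ => mul_nonneg (hlt i).le (sq_nonneg _))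
      ⟨i, Finset.mem_univ _, mul_pos (hlt i) (by positivity)⟩
  refine hB.pseudoEuclideanOn_of_orthogonal ?_
  rw [hB.orthogonal_inf]
  intro z hz hz0
  obtain ⟨v, hv, w, hw, rfl⟩ := Submodule.mem_sup.1 hz
  let x : S₁.perp := ⟨w, hw⟩
  have hu := sub_proj_mem S₁ S₂ x
  have hq : (proj S₁ S₂ x : V) + v ∈ S₂.perp := S₂.perp.add_mem (proj S₁ S₂ x).2 hv
  have huq : B ((x : V) - proj S₁ S₂ x) ((proj S₁ S₂ x : V) + v) = 0 := hq _ hu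
  -- The splitting into components in `U` and `U^⊥`; both have non-negative norm.
  have hdec : v + w = ((x : V) - proj S₁ S₂ x) + ((proj S₁ S₂ x : V) + v) := by
    change v + w = w - _ + (_ + v)
    abel
  have hnorm : B (v + w) (v + w) = B ((x : V) - proj S₁ S₂ x) ((x : V) - proj S₁ S₂ x) +
      B ((proj S₁ S₂ x : V) + v) ((proj S₁ S₂ x : V) + v) := by
    rw [hdec]
    generalize (x : V) - proj S₁ S₂ x = u at *
    generalize (proj S₁ S₂ x : V) + v = y at *
    simp only [map_add, LinearMap.add_apply, huq, hB.symm y u]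
    ring
  by_cases hw0 : w = 0
  · subst hw0
    rw [add_zero] at hz0 ⊢
    exact S₂.perp_euclideanOn hB v hv hz0
  · have h1 := hquad x fun h => hw0 (congrArg Subtype.val h)
    rw [hnorm]
    by_cases h0 : (proj S₁ S₂ x : V) + v = 0
    · rw [h0]; simpa using h1
    · have := S₂.perp_euclideanOn hB _ hq h0
      linarith

end Position

end Subsphere

end Moebius

/-! ### Intersection, separation and interlacing -/

namespace Moebius

namespace Subsphere

variable {V : Type*} [AddCommGroup V] [Module ℝ V] {B : LinearMap.BilinForm ℝ V} {m l n : ℕ}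
  {S₁ : Subsphere B m} {S₂ : Subsphere B l}

theorem mk_mem_points_inter {v : V} (hv : v ≠ 0) :
    Projectivization.mk ℝ v hv ∈ S₁.points ∩ S₂.points ↔
      B v v = 0 ∧ v ∈ S₂.space ⊓ S₁.space := by
  rw [Set.mem_inter_iff, mk_mem_points, mk_mem_points, Submodule.mem_inf]
  tauto

theorem points_inter_eq_empty (h : ∀ v ∈ S₂.space ⊓ S₁.space, B v v = 0 → v = 0) :
    S₁.points ∩ S₂.points = ∅ := by
  refine Set.eq_empty_iff_forall_notMem.2 fun p => ?_
  induction p using Projectivization.ind with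
  | h v hv =>
    rw [mk_mem_points_inter]
    exact fun h' => hv (h v h'.2 h'.1)

theorem points_inter_of_euclideanOn (h : EuclideanOn B (S₂.space ⊓ S₁.space)) :
    S₁.points ∩ S₂.points = ∅ :=
  points_inter_eq_empty fun v hv hvv => by
    by_contra h0
    exact (h v hv h0).ne' hvv

theorem points_inter_of_finrank_eq_one (h : PseudoEuclideanOn B (S₂.space ⊓ S₁.space))
    (h1 : Module.finrank ℝ ↥(S₂.space ⊓ S₁.space) = 1) : S₁.points ∩ S₂.points = ∅ :=
  points_inter_eq_empty fun v hv hvv => by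
    by_contra h0
    obtain ⟨t, ht, htt⟩ := h.exists_timelike
    obtain ⟨c, hc⟩ := exists_smul_eq_of_finrank_eq_one h1
      (x := (⟨v, hv⟩ : ↥(S₂.space ⊓ S₁.space))) (fun h => h0 (congrArg Subtype.val h)) ⟨t, ht⟩
    have hc' : c • v = t := congrArg Subtype.val hc
    rw [← hc'] at htt
    simp [hvv] at htt

/-- The radical is the only null line: a null vector of `U ∩ W` is orthogonal to it, hence
proportional to its generator. -/
theorem points_inter_of_isotropicOn (hB : IsPseudoEuclidean B)
    (h : IsotropicOn B (S₂.space ⊓ S₁.space)) : ∃ p, S₁.points ∩ S₂.points = {p} := by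
  obtain ⟨⟨r, hr, hrX⟩, hr0, -⟩ := finrank_eq_one_iff'.1 h
  have h0 : r ≠ 0 := fun h => hr0 (Subtype.ext h)
  have hrr : B r r = 0 := hrX r hr
  refine ⟨Projectivization.mk ℝ r h0, Set.ext fun p => ?_⟩
  induction p using Projectivization.ind with
  | h v hv =>
    rw [Set.mem_singleton_iff]
    refine ⟨fun hp => ?_, fun hp => ?_⟩
    · rw [mk_mem_points_inter] at hp
      have hrv : B r v = 0 := by rw [hB.symm]; exact hrX v hp.2
      obtain ⟨c, hc⟩ := hB.exists_smul_eq_of_null hrr hp.1 hrv h0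
      exact (Projectivization.mk_eq_mk_iff' ℝ _ _ hv h0).2 ⟨c, hc.symm⟩
    · rw [hp, mk_mem_points_inter]
      exact ⟨hrr, hr⟩

theorem exists_points_inter_eq {k : ℕ} (h : PseudoEuclideanOn B (S₂.space ⊓ S₁.space))
    (h2 : Module.finrank ℝ ↥(S₂.space ⊓ S₁.space) = k + 2) :
    ∃ S : Subsphere B k, S₁.points ∩ S₂.points = S.points := by
  refine ⟨⟨S₂.space ⊓ S₁.space, h, h2⟩, Set.ext fun p => ?_⟩
  induction p using Projectivization.ind with
  | h v hv => rw [mk_mem_points_inter, mk_mem_points]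

variable [FiniteDimensional ℝ V]

/-- The complement `U^⊥ + W^⊥` contains a timelike `v₂ + v₁`. The hyperspheres with normals `v₁` and
`v₂` are disjoint, as a vector in both their spaces is orthogonal to this timelike vector. -/
theorem separable_of_euclideanOn (hB : IsPseudoEuclidean B) (hn : 1 ≤ n)
    (hV : Module.finrank ℝ V = n + 2) (h : EuclideanOn B (S₂.space ⊓ S₁.space)) :
    Separable n S₁ S₂ := by
  obtain ⟨t, ht, htt⟩ : ∃ t ∈ B.orthogonal (S₂.space ⊓ S₁.space), B t t < 0 :=
    (hB.pseudoEuclideanOn_of_orthogonal (by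
      rwa [LinearMap.BilinForm.orthogonal_orthogonal hB.nondegenerate hB.isRefl])).exists_timelike
  rw [hB.orthogonal_inf] at ht
  obtain ⟨v₂, hv₂, v₁, hv₁, rfl⟩ := Submodule.mem_sup.1 ht
  have h₁ : v₁ ≠ 0 := by
    rintro rfl
    rw [add_zero] at htt
    exact lt_asymm htt (S₂.perp_euclideanOn hB _ hv₂ (by rintro rfl; simp at htt))
  have h₂ : v₂ ≠ 0 := by
    rintro rfl
    rw [zero_add] at htt
    exact lt_asymm htt (S₁.perp_euclideanOn hB _ hv₁ (by rintro rfl; simp at htt))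
  obtain ⟨H₁, hH₁, hle₁⟩ := S₁.exists_hypersphere hB hn hV hv₁ h₁
  obtain ⟨H₂, hH₂, hle₂⟩ := S₂.exists_hypersphere hB hn hV hv₂ h₂
  have hx₁ : ∀ x ∈ H₁.space, B v₁ x = 0 := fun x hx => by
    rw [hH₁] at hx
    exact hx v₁ (Submodule.mem_span_singleton_self _)
  have hx₂ : ∀ x ∈ H₂.space, B v₂ x = 0 := fun x hx => by
    rw [hH₂] at hx
    exact hx v₂ (Submodule.mem_span_singleton_self _)
  refine ⟨H₁, H₂, points_subset_of_space_le hle₁, points_subset_of_space_le hle₂,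
    points_inter_of_euclideanOn (hB.euclideanOn_of_timelike_orthogonal htt fun x hx => by
      rw [map_add, LinearMap.add_apply, hx₁ x hx.2, hx₂ x hx.1, add_zero]), fun _ => ?_⟩
  intro v hv x hx y hy hxx hyy hxy
  rw [Subsphere.perp, hH₁,
    LinearMap.BilinForm.orthogonal_orthogonal hB.nondegenerate hB.isRefl] at hv
  obtain ⟨c, rfl⟩ := Submodule.mem_span_singleton.1 hv
  -- On `H₂` the products with `v₂ + v₁` and with `v₁` agree, so the timelike vector fixes the side.
  have h3 := hB.mul_apply_nonneg_of_null htt hxx hyy hxy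
  simp only [map_add, LinearMap.add_apply, hx₂ x hx, hx₂ y hy, zero_add] at h3
  simp only [map_smul, LinearMap.smul_apply, smul_eq_mul]
  nlinarith [mul_nonneg (sq_nonneg c) h3]

/-- Disjointness leaves no null vector in the intersection of the hypersphere spaces, so only a
timelike `t` must be excluded. For `n ≥ 2` that intersection has dimension at least two, and `t`
would produce a null vector. For `n = 1` it may be a timelike line, and the condition on arcs is
needed. -/
theorem euclideanOn_of_separable (hB : IsPseudoEuclidean B) (hn : 1 ≤ n)
    (hV : Module.finrank ℝ V = n + 2) (hS : S₁.perp ⊓ S₂.perp = ⊥)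
    (h : Separable n S₁ S₂) : EuclideanOn B (S₂.space ⊓ S₁.space) := by
  obtain ⟨H₁, H₂, hSH₁, hSH₂, hdis, hside⟩ := h
  have hle₁ := space_le_of_points_subset hB hSH₁
  have hle₂ := space_le_of_points_subset hB hSH₂
  have hnull : ∀ x ∈ H₂.space ⊓ H₁.space, B x x = 0 → x = 0 := by
    intro x hx hxx
    by_contra h0
    have := (mk_mem_points_inter (S₁ := H₁) (S₂ := H₂) h0).2 ⟨hxx, hx⟩
    rw [hdis] at this
    exact this
  suffices hE : ∀ t ∈ H₂.space ⊓ H₁.space, ¬ B t t < 0 by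
    intro x hx hx0
    have hx' : x ∈ H₂.space ⊓ H₁.space := ⟨hle₂ hx.1, hle₁ hx.2⟩
    exact lt_of_le_of_ne (not_lt.1 (hE x hx')) fun h => hx0 (hnull x hx' h.symm)
  intro t ht htt
  rcases eq_or_lt_of_le hn with rfl | hn
  · have hv : H₁.perp ≠ ⊥ := fun h => by
      have := H₁.finrank_perp hB hV
      rw [h, finrank_bot] at this
      omega
    obtain ⟨v, hv, hv0⟩ := Submodule.exists_mem_ne_zero_of_ne_bot hv
    have hvt : B v t = 0 := by rw [hB.symm]; exact hv t ht.2
    have hker : H₂.space ≤ LinearMap.ker (B v) := space_le_of_null_mem hB H₂ fun x hx hxx => by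
      rw [LinearMap.mem_ker]
      by_cases h0 : x = 0
      · rw [h0, map_zero]
      have htx : B t x ≠ 0 := fun h => (hB.pos_of_orthogonal_timelike htt h h0).ne' hxx
      have hxt : B x t = B t x := hB.symm x t
      have htt0 := htt.ne
      -- Minus the reflection of `x` in `t^⊥`: a null vector of `H₂` in the same half cone whose
      -- product with `v` is `-⟨v, x⟩`. One-sidedness forces `⟨v, x⟩ = 0`, so `v` is normal to both
      -- spheres.
      have h1 := hside rfl v hv x hx ((2 * (B t x / B t t)) • t - x)
        (H₂.space.sub_mem (H₂.space.smul_mem _ ht.1) hx) hxx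
        (by
          simp only [map_sub, map_smul, LinearMap.sub_apply, LinearMap.smul_apply, smul_eq_mul,
            hxx, hxt]
          field_simp
          ring)
        (by
          simp only [map_sub, map_smul, smul_eq_mul, hxx, hxt, sub_zero]
          have h2 : 2 * (B t x / B t t) * B t x = 2 * (B t x ^ 2 / B t t) := by ring
          rw [h2]
          have := div_neg_of_pos_of_neg (show 0 < B t x ^ 2 by positivity) htt
          linarith)
      simp only [map_sub, map_smul, smul_eq_mul, hvt, mul_zero, zero_sub] at h1
      nlinarith [sq_nonneg (B v x)]
    have hmem : v ∈ S₁.perp ⊓ S₂.perp :=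
      ⟨LinearMap.BilinForm.orthogonal_le hle₁ hv, fun x hx => by
        change B x v = 0
        rw [hB.symm]
        exact hker (hle₂ hx)⟩
    rw [hS, Submodule.mem_bot] at hmem
    exact hv0 hmem
  · have hdim : 2 ≤ Module.finrank ℝ ↥(H₂.space ⊓ H₁.space) := by
      have h1 := Submodule.finrank_sup_add_finrank_inf_eq H₂.space H₁.space
      have h2 := Submodule.finrank_le (H₂.space ⊔ H₁.space)
      rw [H₁.finrank_eq, H₂.finrank_eq] at h1
      omega
    obtain ⟨s, hs, hts, hss⟩ := hB.exists_orthogonal_spacelike _ hdim ht htt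
    have h1 := hnull (t + s) (Submodule.add_mem _ ht hs) (by simp [hts, hB.symm s t, hss])
    have h2 : B t (t + s) = 0 := by rw [h1, map_zero]
    rw [map_add, hts, add_zero] at h2
    exact htt.ne h2

/-- The mutual position of two spheres in general position. -/
theorem GeneralPosition.position (hB : IsPseudoEuclidean B) (hmn : m < n)
    (hV : Module.finrank ℝ V = n + 2) (h : GeneralPosition n S₁ S₂) :
    List.TFAE [
      1 < eigenvalue S₁ S₂ 0,
      EuclideanOn B (S₂.space ⊓ S₁.space),
      Separable n S₁ S₂] ∧
    (eigenvalue S₁ S₂ 0 < 1 ↔ PseudoEuclideanOn B (S₂.space ⊓ S₁.space)) ∧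
    List.TFAE [
      eigenvalue S₁ S₂ 0 < 1 ∧ 1 < Module.finrank ℝ ↥(S₂.space ⊓ S₁.space),
      PseudoEuclideanOn B (S₂.space ⊓ S₁.space) ∧
        2 ≤ Module.finrank ℝ ↥(S₂.space ⊓ S₁.space),
      ∃ (k : ℕ) (S : Subsphere B k), S₁.points ∩ S₂.points = S.points,
      ∃ (k : ℕ) (S : Subsphere B k), k + n = m + l ∧ S₁.points ∩ S₂.points = S.points] ∧
    List.TFAE [
      eigenvalue S₁ S₂ 0 < 1 ∧ Module.finrank ℝ ↥(S₂.space ⊓ S₁.space) = 1,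
      PseudoEuclideanOn B (S₂.space ⊓ S₁.space) ∧
        Module.finrank ℝ ↥(S₂.space ⊓ S₁.space) = 1,
      Interlaced n S₁ S₂] ∧
    (Interlaced n S₁ S₂ → m + l + 1 = n) ∧
    List.TFAE [
      eigenvalue S₁ S₂ 0 = 1,
      IsotropicOn B (S₂.space ⊓ S₁.space),
      ∃ p, S₁.points ∩ S₂.points = {p}] := by
  have hn : 1 ≤ n := by omega
  have hS := h.perp_inf_perp hB hn hV
  have hdim := h.finrank_inf hB hn hV
  have hgt : 1 < eigenvalue S₁ S₂ 0 → EuclideanOn B (S₂.space ⊓ S₁.space) :=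
    euclideanOn_of_one_lt_eigenvalue hB hmn hV
  have heq : eigenvalue S₁ S₂ 0 = 1 → IsotropicOn B (S₂.space ⊓ S₁.space) :=
    isotropicOn_of_eigenvalue_eq_one hB hmn hV hS
  have hlt : eigenvalue S₁ S₂ 0 < 1 → PseudoEuclideanOn B (S₂.space ⊓ S₁.space) :=
    pseudoEuclideanOn_of_eigenvalue_lt_one hB hV
  have hgt' : 1 < eigenvalue S₁ S₂ 0 ↔ EuclideanOn B (S₂.space ⊓ S₁.space) := by
    refine ⟨hgt, fun hE => ?_⟩
    rcases lt_trichotomy (eigenvalue S₁ S₂ 0) 1 with h1 | h1 | h1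
    · exact absurd (hlt h1) hE.not_pseudoEuclideanOn
    · exact absurd (heq h1) hE.not_isotropicOn
    · exact h1
  have hlt' : eigenvalue S₁ S₂ 0 < 1 ↔ PseudoEuclideanOn B (S₂.space ⊓ S₁.space) := by
    refine ⟨hlt, fun hP => ?_⟩
    rcases lt_trichotomy (eigenvalue S₁ S₂ 0) 1 with h1 | h1 | h1
    · exact h1
    · exact absurd (heq h1) (hB.not_isotropicOn hP)
    · exact absurd hP (hgt h1).not_pseudoEuclideanOn
  have heq' : eigenvalue S₁ S₂ 0 = 1 ↔ IsotropicOn B (S₂.space ⊓ S₁.space) := by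
    refine ⟨heq, fun hI => ?_⟩
    rcases lt_trichotomy (eigenvalue S₁ S₂ 0) 1 with h1 | h1 | h1
    · exact absurd hI (hB.not_isotropicOn (hlt h1))
    · exact h1
    · exact absurd hI (hgt h1).not_isotropicOn
  have hsep : EuclideanOn B (S₂.space ⊓ S₁.space) ↔ Separable n S₁ S₂ :=
    ⟨separable_of_euclideanOn hB hn hV, euclideanOn_of_separable hB hn hV hS⟩
  have hcases : EuclideanOn B (S₂.space ⊓ S₁.space) ∨ IsotropicOn B (S₂.space ⊓ S₁.space) ∨
      PseudoEuclideanOn B (S₂.space ⊓ S₁.space) := by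
    rw [← hgt', ← heq', ← hlt']
    rcases lt_trichotomy (eigenvalue S₁ S₂ 0) 1 with h1 | h1 | h1 <;> tauto
  have hpos : PseudoEuclideanOn B (S₂.space ⊓ S₁.space) →
      1 ≤ Module.finrank ℝ ↥(S₂.space ⊓ S₁.space) := fun ⟨k, b, _⟩ => by
    rw [Module.finrank_eq_card_basis b, Fintype.card_fin]
    omega
  have hsphere : PseudoEuclideanOn B (S₂.space ⊓ S₁.space) →
      2 ≤ Module.finrank ℝ ↥(S₂.space ⊓ S₁.space) →
      ∃ (k : ℕ) (S : Subsphere B k), k + n = m + l ∧ S₁.points ∩ S₂.points = S.points :=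
    fun hP h2 => by
      obtain ⟨k, hk⟩ : ∃ k, Module.finrank ℝ ↥(S₂.space ⊓ S₁.space) = k + 2 :=
        ⟨_, (Nat.sub_add_cancel h2).symm⟩
      obtain ⟨S, hSp⟩ := exists_points_inter_eq hP hk
      exact ⟨k, S, by omega, hSp⟩
  have hinter : Interlaced n S₁ S₂ → PseudoEuclideanOn B (S₂.space ⊓ S₁.space) ∧
      Module.finrank ℝ ↥(S₂.space ⊓ S₁.space) = 1 := by
    rintro ⟨hem, hns⟩
    rcases hcases with h1 | h1 | h1
    · exact absurd (hsep.1 h1) hns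
    · obtain ⟨p, hp⟩ := points_inter_of_isotropicOn hB h1
      rw [hem] at hp
      exact absurd hp.symm (Set.singleton_ne_empty p)
    · refine ⟨h1, ?_⟩
      by_contra h2
      have h3 := hpos h1
      obtain ⟨k, S, -, hSp⟩ := hsphere h1 (by omega)
      obtain ⟨p, hp, -⟩ := S.exists_ne_mem_points hB
      rw [← hSp, hem] at hp
      exact hp
  refine ⟨?_, hlt', ?_, ?_, fun hI => ?_, ?_⟩
  · tfae_have 1 ↔ 2 := hgt'
    tfae_have 2 ↔ 3 := hsep
    tfae_finish
  · tfae_have 1 ↔ 2 := and_congr hlt' Iff.rfl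
    tfae_have 2 → 4 := fun h => hsphere h.1 h.2
    tfae_have 4 → 3 := fun ⟨k, S, _, h⟩ => ⟨k, S, h⟩
    -- A sphere has at least two points, which rules out every case with an empty or one-point
    -- intersection.
    tfae_have 3 → 2 := by
      rintro ⟨k, S, hSp⟩
      obtain ⟨p, hp, q, hq, hpq⟩ := S.exists_ne_mem_points hB
      rw [← hSp] at hp hq
      rcases hcases with h1 | h1 | h1
      · rw [points_inter_of_euclideanOn h1] at hp
        exact hp.elim
      · obtain ⟨r, hr⟩ := points_inter_of_isotropicOn hB h1
        rw [hr] at hp hq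
        exact absurd (hp.trans hq.symm) hpq
      · refine ⟨h1, ?_⟩
        by_contra h2
        have h3 := hpos h1
        rw [points_inter_of_finrank_eq_one h1 (by omega)] at hp
        exact hp
    tfae_finish
  · tfae_have 1 ↔ 2 := and_congr hlt' Iff.rfl
    tfae_have 2 → 3 := fun h => ⟨points_inter_of_finrank_eq_one h.1 h.2,
      fun hs => (hsep.2 hs).not_pseudoEuclideanOn h.1⟩
    tfae_have 3 → 2 := hinter
    tfae_finish
  · have := (hinter hI).2
    omega
  · tfae_have 1 ↔ 2 := heq'
    tfae_have 2 → 3 := points_inter_of_isotropicOn hB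
    tfae_have 3 → 2 := by
      rintro ⟨p, hp⟩
      rcases hcases with h1 | h1 | h1
      · rw [points_inter_of_euclideanOn h1] at hp
        exact absurd hp.symm (Set.singleton_ne_empty p)
      · exact h1
      · have h3 := hpos h1
        by_cases h2 : Module.finrank ℝ ↥(S₂.space ⊓ S₁.space) = 1
        · rw [points_inter_of_finrank_eq_one h1 h2] at hp
          exact absurd hp.symm (Set.singleton_ne_empty p)
        · obtain ⟨k, S, -, hSp⟩ := hsphere h1 (by omega)
          obtain ⟨q, hq, r, hr, hqr⟩ := S.exists_ne_mem_points hB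
          rw [← hSp, hp] at hq hr
          exact absurd (hq.trans hr.symm) hqr
    tfae_finish

end Subsphere

end Moebius

/-! ### Completeness of the eigenvalues as invariants -/

namespace Moebius

variable {V : Type*} [AddCommGroup V] [Module ℝ V] {B : LinearMap.BilinForm ℝ V}

theorem map_orthogonal_of_similarity {F : V ≃ₗ[ℝ] V} {c : ℝ} (hc : c ≠ 0)
    (hF : ∀ x y, B (F x) (F y) = c * B x y) (X : Submodule ℝ V) :
    (B.orthogonal X).map F.toLinearMap = B.orthogonal (X.map F.toLinearMap) := by
  ext y
  obtain ⟨x, rfl⟩ := F.surjective y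
  have hmap : ∀ Y : Submodule ℝ V, F x ∈ Y.map F.toLinearMap ↔ x ∈ Y := fun Y =>
    ⟨fun ⟨z, hz, hzx⟩ => F.injective hzx ▸ hz, fun h => ⟨x, h, rfl⟩⟩
  rw [hmap]
  constructor
  · rintro hx _ ⟨z, hz, rfl⟩
    have h : B z x = 0 := hx z hz
    change B (F z) (F x) = 0
    rw [hF, h, mul_zero]
  · intro hx z hz
    have h : B (F z) (F x) = 0 := hx (F z) ⟨z, hz, rfl⟩
    rw [hF] at h
    exact (mul_eq_zero.1 h).resolve_left hc

/-- The pulled-back form vanishes on the light cone, hence is a multiple of `B`; the factor is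
non-zero because `F` is onto and timelike vectors exist. -/
theorem exists_similarity_of_mem_moebiusGroup (hB : IsPseudoEuclidean B)
    {g : Equiv.Perm (ℙ ℝ V)} (hg : g ∈ moebiusGroup B) :
    ∃ (F : V ≃ₗ[ℝ] V) (c : ℝ), c ≠ 0 ∧ (∀ x y, B (F x) (F y) = c * B x y) ∧
      MulAction.toPermHom (V ≃ₗ[ℝ] V) (ℙ ℝ V) F = g := by
  obtain ⟨⟨F, hFg⟩, hstab⟩ := hg
  have hnull : ∀ x, B x x = 0 → B (F x) (F x) = 0 := fun x hx => by
    by_cases h0 : x = 0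
    · simp [h0]
    have h1 := (MulAction.mem_stabilizer_set.1 hstab (Projectivization.mk ℝ x h0)).2
      ((mk_mem_quadric h0).2 hx)
    rw [← hFg, Equiv.Perm.smul_def, linearEquiv_smul_mk, mk_mem_quadric] at h1
    exact h1
  obtain ⟨c, hc⟩ := hB.exists_eq_mul_of_null
    (C := LinearMap.BilinForm.comp B F.toLinearMap F.toLinearMap)
    (fun x y => hB.symm (F x) (F y)) hnull
  have hc' : ∀ x y, B (F x) (F y) = c * B x y := hc
  refine ⟨F, c, ?_, hc', hFg⟩
  rintro rfl
  obtain ⟨t, ht, -⟩ := hB.exists_timelike_orthogonal_pos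
  have h2 := hc' (F.symm t) (F.symm t)
  simp only [LinearEquiv.apply_symm_apply, zero_mul] at h2
  exact ht.ne h2

/-- An orthogonal family of vectors of a euclidean subspace extends to an orthogonal basis by
unit vectors. -/
theorem EuclideanOn.exists_orthogonal_extension [FiniteDimensional ℝ V]
    (hB : ∀ x y, B x y = B y x) {X : Submodule ℝ V} (hX : EuclideanOn B X) {ι : Type*} [Fintype ι]
    {z : ι → V} (hzX : ∀ i, z i ∈ X) (hz0 : ∀ i, z i ≠ 0)
    (hz : Pairwise fun i j => B (z i) (z j) = 0) {r : ℕ}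
    (hr : r = Module.finrank ℝ X - Fintype.card ι) :
    ∃ y : Fin r → V, (∀ i j, B (y i) (y j) = if i = j then 1 else 0) ∧
      (∀ i j, B (z i) (y j) = 0) ∧ LinearIndependent ℝ (Sum.elim z y) ∧
      Submodule.span ℝ (Set.range (Sum.elim z y)) = X := by
  classical
  have hzne : ∀ i, B (z i) (z i) ≠ 0 := fun i => (hX _ (hzX i) (hz0 i)).ne'
  have hzli : LinearIndependent ℝ z :=
    LinearMap.BilinForm.linearIndependent_of_iIsOrtho (B := B) (fun i j hij => hz hij) hzne
  set Z := Submodule.span ℝ (Set.range z) with hZ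
  have hZX : Z ≤ X := Submodule.span_le.2 (by rintro _ ⟨i, rfl⟩; exact hzX i)
  have hrefl : B.IsRefl := fun x y h => by rw [hB, h]
  have hdis : Disjoint Z (B.orthogonal Z) := Submodule.disjoint_def.2 fun x hx hx' => by
    by_contra h0
    exact (hX x (hZX hx) h0).ne' (hx' x hx)
  have hcompl := (LinearMap.BilinForm.isCompl_orthogonal_iff_disjoint hrefl).2 hdis
  -- The modular law: `Z ≤ X` and `V = Z ⊕ Z^⊥`.
  have hsup : Z ⊔ B.orthogonal Z ⊓ X = X := by
    rw [← sup_inf_assoc_of_le _ hZX, hcompl.sup_eq_top, top_inf_eq]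
  have hrank : Module.finrank ℝ ↥(B.orthogonal Z ⊓ X) = r := by
    have h1 := Submodule.finrank_sup_add_finrank_inf_eq Z (B.orthogonal Z ⊓ X)
    rw [hsup, ← inf_assoc, hdis.eq_bot, bot_inf_eq, finrank_bot, finrank_span_eq_card hzli] at h1
    omega
  obtain ⟨a, ha⟩ := exists_orthonormal_basis (B.restrict (B.orthogonal Z ⊓ X))
    (fun x y => hB _ _) (fun x hx => hX x x.2.2 (by simpa using hx)) hrank
  have ha' : ∀ i j, B (a i : V) (a j : V) = if i = j then 1 else 0 := ha
  have hza : ∀ i j, B (z i) (a j : V) = 0 := fun i j =>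
    (a j).2.1 (z i) (Submodule.subset_span ⟨i, rfl⟩)
  have hli : LinearIndependent ℝ (Sum.elim z fun j => (a j : V)) := by
    refine LinearMap.BilinForm.linearIndependent_of_iIsOrtho (B := B) ?_ ?_
    · rintro (i | i) (j | j) hij
      · exact hz fun h => hij (congrArg _ h)
      · exact hza i j
      · change B (a i : V) (z j) = 0
        rw [hB, hza]
      · change B (a i : V) (a j : V) = 0
        rw [ha', if_neg fun h => hij (congrArg _ h)]
    · rintro (i | i)
      · exact hzne i
      · change B (a i : V) (a i : V) ≠ 0
        simp [ha']
  refine ⟨fun j => a j, ha', hza, hli, Submodule.eq_of_le_of_finrank_eq ?_ ?_⟩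
  · refine Submodule.span_le.2 ?_
    rintro _ ⟨i | j, rfl⟩
    · exact hzX i
    · exact (a j).2.2
  · have h1 := Submodule.finrank_mono hZX
    rw [finrank_span_eq_card hzli] at h1
    rw [finrank_span_eq_card hli, Fintype.card_sum, Fintype.card_fin]
    omega

namespace Subsphere

variable {m l n : ℕ}

theorem map_space_of_image_points [FiniteDimensional ℝ V] (hB : IsPseudoEuclidean B)
    {S T : Subsphere B m} {F : V ≃ₗ[ℝ] V}
    (h : MulAction.toPermHom (V ≃ₗ[ℝ] V) (ℙ ℝ V) F '' S.points = T.points) :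
    S.space.map F.toLinearMap = T.space := by
  refine Submodule.eq_of_le_of_finrank_eq ?_ ?_
  · rw [Submodule.map_le_iff_le_comap]
    refine space_le_of_null_mem hB S fun x hx hxx => ?_
    by_cases h0 : x = 0
    · rw [h0]; exact Submodule.zero_mem _
    have h1 := Set.mem_image_of_mem (MulAction.toPermHom (V ≃ₗ[ℝ] V) (ℙ ℝ V) F)
      ((mk_mem_points (S := S) h0).2 ⟨hxx, hx⟩)
    rw [h, linearEquiv_smul_mk, mk_mem_points] at h1
    exact h1.2
  · rw [T.finrank_eq, ← S.finrank_eq]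
    exact LinearEquiv.finrank_map_eq F S.space

theorem image_points_of_map_space {S T : Subsphere B m} {F : V ≃ₗ[ℝ] V}
    (hF : ∀ x y, B (F x) (F y) = B x y) (h : S.space.map F.toLinearMap = T.space) :
    MulAction.toPermHom (V ≃ₗ[ℝ] V) (ℙ ℝ V) F '' S.points = T.points := by
  have key : ∀ p, MulAction.toPermHom (V ≃ₗ[ℝ] V) (ℙ ℝ V) F p ∈ T.points ↔ p ∈ S.points := by
    intro p
    induction p using Projectivization.ind with
    | h v hv =>
      rw [linearEquiv_smul_mk, mk_mem_points, mk_mem_points, hF, ← h]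
      exact and_congr_right fun _ =>
        ⟨fun ⟨z, hz, hzx⟩ => F.injective hzx ▸ hz, fun h => ⟨v, h, rfl⟩⟩
  ext p
  obtain ⟨q, rfl⟩ := (MulAction.toPermHom (V ≃ₗ[ℝ] V) (ℙ ℝ V) F).surjective p
  rw [key, Function.Injective.mem_set_image (Equiv.injective _)]

theorem moebiusEquivalent_of_isometry {S₁ T₁ : Subsphere B m} {S₂ T₂ : Subsphere B l}
    {F : V ≃ₗ[ℝ] V} (hF : ∀ x y, B (F x) (F y) = B x y)
    (h₁ : S₁.space.map F.toLinearMap = T₁.space) (h₂ : S₂.space.map F.toLinearMap = T₂.space) :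
    MoebiusEquivalent S₁ S₂ T₁ T₂ := by
  refine ⟨MulAction.toPermHom (V ≃ₗ[ℝ] V) (ℙ ℝ V) F, ⟨⟨F, rfl⟩, ?_⟩,
    image_points_of_map_space hF h₁, image_points_of_map_space hF h₂⟩
  refine MulAction.mem_stabilizer_set.2 fun p => ?_
  induction p using Projectivization.ind with
  | h v hv => rw [Equiv.Perm.smul_def, linearEquiv_smul_mk, mk_mem_quadric, mk_mem_quadric, hF]

/-- A similarity preserves orthogonality, so it intertwines the projections and conjugates the
operators; the factor `c` plays no further role. -/
theorem eigenvalue_eq_of_similarity [FiniteDimensional ℝ V] {S₁ T₁ : Subsphere B m}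
    {S₂ T₂ : Subsphere B l} {F : V ≃ₗ[ℝ] V} {c : ℝ} (hc : c ≠ 0)
    (hF : ∀ x y, B (F x) (F y) = c * B x y)
    (h₁ : S₁.space.map F.toLinearMap = T₁.space) (h₂ : S₂.space.map F.toLinearMap = T₂.space) :
    eigenvalue S₁ S₂ = eigenvalue T₁ T₂ := by
  have hp₁ : S₁.perp.map F.toLinearMap = T₁.perp := by
    rw [Subsphere.perp, map_orthogonal_of_similarity hc hF, h₁]
  have hp₂ : S₂.perp.map F.toLinearMap = T₂.perp := by
    rw [Subsphere.perp, map_orthogonal_of_similarity hc hF, h₂]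
  let e₁ : S₁.perp ≃ₗ[ℝ] T₁.perp := F.ofSubmodules _ _ hp₁
  let e₂ : S₂.perp ≃ₗ[ℝ] T₂.perp := F.ofSubmodules _ _ hp₂
  have hproj : ∀ x, proj T₁ T₂ (e₁ x) = e₂ (proj S₁ S₂ x) := fun x =>
    proj_eq_of_sub_mem (by
      change F x - F (proj S₁ S₂ x) ∈ T₂.space
      rw [← map_sub, ← h₂]
      exact ⟨_, sub_proj_mem S₁ S₂ x, rfl⟩)
  have hproj' : ∀ x, proj T₂ T₁ (e₂ x) = e₁ (proj S₂ S₁ x) := fun x =>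
    proj_eq_of_sub_mem (by
      change F x - F (proj S₂ S₁ x) ∈ T₁.space
      rw [← map_sub, ← h₁]
      exact ⟨_, sub_proj_mem S₂ S₁ x, rfl⟩)
  have hconj : opA T₁ T₂ = e₁.conj (opA S₁ S₂) := by
    refine LinearMap.ext fun y => ?_
    obtain ⟨x, rfl⟩ := e₁.surjective y
    rw [LinearEquiv.conj_apply_apply, LinearEquiv.symm_apply_apply]
    change proj T₂ T₁ (proj T₁ T₂ (e₁ x)) = _
    rw [hproj, hproj']
    rfl
  funext i
  simp only [eigenvalue, hconj, LinearEquiv.charpoly_conj]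

open Classical in
/-- The Gram matrix of a family adapted to a pair of spheres with eigenvalues `α`. -/
noncomputable def adaptedGram {N r : ℕ} (α : Fin N → ℝ) :
    Fin N ⊕ ({i // α i ≠ 0} ⊕ Fin r) → Fin N ⊕ ({i // α i ≠ 0} ⊕ Fin r) → ℝ
  | .inl i, .inl j => if i = j then 1 else 0
  | .inl i, .inr (.inl j) => if i = j then α i else 0
  | .inr (.inl i), .inl j => if i = j then α i else 0
  | .inr (.inl i), .inr (.inl j) => if i = j then α i else 0
  | .inr (.inr i), .inr (.inr j) => if i = j then 1 else 0
  | _, _ => 0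

open Classical in
/-- The complements of two spheres in general position have bases whose joint Gram matrix is
determined by the eigenvalues. -/
theorem exists_adapted_family [FiniteDimensional ℝ V] (hB : IsPseudoEuclidean B)
    (hV : Module.finrank ℝ V = n + 2) (S₁ : Subsphere B m) (S₂ : Subsphere B l)
    (hS : S₁.perp ⊓ S₂.perp = ⊥) {α : Fin (n - m) → ℝ}
    (hα : ∀ i : Fin (n - m), eigenvalue S₁ S₂ i = α i) :
    ∃ x : Fin (n - m) ⊕ ({i // α i ≠ 0} ⊕ Fin (n - l - Fintype.card {i // α i ≠ 0})) → V,
      LinearIndependent ℝ x ∧ Submodule.span ℝ (Set.range (x ∘ Sum.inl)) = S₁.perp ∧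
      Submodule.span ℝ (Set.range (x ∘ Sum.inr)) = S₂.perp ∧
      ∀ p q, B (x p) (x q) = adaptedGram α p q := by
  obtain ⟨⟨a, ha, haα⟩, -, -⟩ := exists_eigenbasis hB S₁ S₂ hV
  have hbb : ∀ i j, B (proj S₁ S₂ (a i)) (proj S₁ S₂ (a j)) = if i = j then α i else 0 := by
    intro i j
    rw [← apply_opA hB, haα, Submodule.coe_smul, map_smul, LinearMap.smul_apply, ha, hα]
    split_ifs <;> simp
  have hab : ∀ i j, B (a i) (proj S₁ S₂ (a j)) = if i = j then α i else 0 := by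
    intro i j
    rw [← apply_proj, hbb]
  have hb0 : ∀ i, α i = 0 → (proj S₁ S₂ (a i) : V) = 0 := by
    intro i hi
    by_contra h0
    have := S₂.perp_euclideanOn hB _ (proj S₁ S₂ (a i)).2 h0
    rw [hbb, if_pos rfl, hi] at this
    exact this.false
  -- Projections with eigenvalue `0` vanish; the others are orthogonal and are completed to a basis
  -- of `U^⊥`.
  obtain ⟨y, hy, hzy, hli, hspan⟩ := (S₂.perp_euclideanOn hB).exists_orthogonal_extension hB.symm
    (z := fun i : {i // α i ≠ 0} => (proj S₁ S₂ (a i) : V))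
    (r := n - l - Fintype.card {i // α i ≠ 0})
    (fun i => (proj S₁ S₂ (a i)).2)
    (fun i h => i.2 (by
      have := hbb i i
      rw [h, if_pos rfl] at this
      simpa using this.symm))
    (fun i j hij => by
      change B _ _ = 0
      rw [hbb, if_neg fun h => hij (Subtype.ext h)])
    (by rw [S₂.finrank_perp hB hV])
  have hay : ∀ i j, B (a i) (y j) = 0 := by
    intro i j
    have hyS : y j ∈ S₂.perp := by
      rw [← hspan]
      exact Submodule.subset_span ⟨.inr j, rfl⟩
    rw [← apply_proj S₁ S₂ (a i) ⟨y j, hyS⟩]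
    by_cases hi : α i = 0
    · rw [hb0 i hi]; simp
    · exact hzy ⟨i, hi⟩ j
  have hspan₁ : Submodule.span ℝ (Set.range fun i => (a i : V)) = S₁.perp := by
    have h1 : (Set.range fun i => (a i : V)) = S₁.perp.subtype '' Set.range a := by
      rw [← Set.range_comp]; rfl
    rw [h1, Submodule.span_image, a.span_eq, Submodule.map_top, Submodule.range_subtype]
  have hli₁ : LinearIndependent ℝ fun i => (a i : V) :=
    a.linearIndependent.map' S₁.perp.subtype S₁.perp.ker_subtype
  refine ⟨Sum.elim (fun i => (a i : V)) (Sum.elim _ y), hli₁.sum_type hli ?_, hspan₁, hspan, ?_⟩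
  · rw [hspan₁, hspan]
    exact disjoint_iff.2 hS
  · rintro (i | i | i) (j | j | j) <;>
      simp only [Sum.elim_inl, Sum.elim_inr, adaptedGram]
    · rw [ha]
    · rw [hab]
    · rw [hay]
    · rw [hB.symm, hab]
      split_ifs with h1 h2 h2
      · rw [h1]
      · exact absurd h1.symm h2
      · exact absurd h2.symm h1
      · rfl
    · rw [hbb]
      simp only [Subtype.ext_iff]
    · rw [hzy]
    · rw [hB.symm, hay]
    · rw [hB.symm, hzy]
    · rw [hy]

theorem moebiusEquivalent_iff_eigenvalue_eq [FiniteDimensional ℝ V] (hB : IsPseudoEuclidean B)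
    (hn : 1 ≤ n) (hV : Module.finrank ℝ V = n + 2) {S₁ T₁ : Subsphere B m} {S₂ T₂ : Subsphere B l}
    (hS : GeneralPosition n S₁ S₂) (hT : GeneralPosition n T₁ T₂) :
    MoebiusEquivalent S₁ S₂ T₁ T₂ ↔ ∀ i < n - m, eigenvalue S₁ S₂ i = eigenvalue T₁ T₂ i := by
  constructor
  · rintro ⟨g, hg, h₁, h₂⟩ i -
    obtain ⟨F, c, hc, hF, rfl⟩ := exists_similarity_of_mem_moebiusGroup hB hg
    rw [eigenvalue_eq_of_similarity hc hF (map_space_of_image_points hB h₁)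
      (map_space_of_image_points hB h₂)]
  · intro h
    -- Both families use the eigenvalues of the second pair as `α`, so that their index types
    -- coincide.
    obtain ⟨x, hx, hx₁, hx₂, hxg⟩ := exists_adapted_family hB hV S₁ S₂ (hS.perp_inf_perp hB hn hV)
      (α := fun i => eigenvalue T₁ T₂ i) fun i => h i i.2
    obtain ⟨y, hy, hy₁, hy₂, hyg⟩ := exists_adapted_family hB hV T₁ T₂ (hT.perp_inf_perp hB hn hV)
      (α := fun i => eigenvalue T₁ T₂ i) fun i => rfl
    obtain ⟨R, hR, hRx⟩ := hB.exists_isometry_extending hx hy fun p q => by rw [hxg, hyg]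
    have hspace : ∀ {k : ℕ} (S T : Subsphere B k), S.perp.map R.toLinearMap = T.perp →
        S.space.map R.toLinearMap = T.space := fun S T hST => by
      rw [← S.orthogonal_perp hB, map_orthogonal_of_similarity one_ne_zero
        (by simpa using hR), hST, T.orthogonal_perp hB]
    refine moebiusEquivalent_of_isometry hR (hspace _ _ ?_) (hspace _ _ ?_)
    · rw [← hx₁, ← hy₁, Submodule.map_span, ← Set.range_comp]
      congr 2
      funext i
      exact hRx _
    · rw [← hx₂, ← hy₂, Submodule.map_span, ← Set.range_comp]
      congr 2
      funext i
      exact hRx _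

end Subsphere

end Moebius

theorem mainTheorem1 {V : Type*} [AddCommGroup V] [Module ℝ V] [FiniteDimensional ℝ V]
    (n m l : ℕ) (hmn : m < n) (hlm : l ≤ m)
    (B : LinearMap.BilinForm ℝ V) (hB : IsPseudoEuclidean B)
    (hV : Module.finrank ℝ V = n + 2) :
    -- the eigenvalues of the self-adjoint operator `A`, and the four mutual positions
    (∀ (S₁ : Subsphere B m) (S₂ : Subsphere B l), GeneralPosition n S₁ S₂ →
      (∀ x y : S₁.perp, B (opA S₁ S₂ x) y = B x (opA S₁ S₂ y)) ∧
      (∃ a : Module.Basis (Fin (n - m)) ℝ S₁.perp,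
        (∀ i j, B (a i) (a j) = if i = j then 1 else 0) ∧
        ∀ i : Fin (n - m), opA S₁ S₂ (a i) = eigenvalue S₁ S₂ i • a i) ∧
      (∀ i j : ℕ, i ≤ j → j < n - m → eigenvalue S₁ S₂ j ≤ eigenvalue S₁ S₂ i) ∧
      (∀ i < n - m, 0 ≤ eigenvalue S₁ S₂ i) ∧
      List.TFAE [
        1 < eigenvalue S₁ S₂ 0,
        EuclideanOn B (S₂.space ⊓ S₁.space),
        Separable n S₁ S₂] ∧
      (eigenvalue S₁ S₂ 0 < 1 ↔ PseudoEuclideanOn B (S₂.space ⊓ S₁.space)) ∧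
      List.TFAE [
        eigenvalue S₁ S₂ 0 < 1 ∧ 1 < Module.finrank ℝ ↥(S₂.space ⊓ S₁.space),
        PseudoEuclideanOn B (S₂.space ⊓ S₁.space) ∧
          2 ≤ Module.finrank ℝ ↥(S₂.space ⊓ S₁.space),
        ∃ (k : ℕ) (S : Subsphere B k), S₁.points ∩ S₂.points = S.points,
        ∃ (k : ℕ) (S : Subsphere B k), k + n = m + l ∧ S₁.points ∩ S₂.points = S.points] ∧
      List.TFAE [
        eigenvalue S₁ S₂ 0 < 1 ∧ Module.finrank ℝ ↥(S₂.space ⊓ S₁.space) = 1,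
        PseudoEuclideanOn B (S₂.space ⊓ S₁.space) ∧
          Module.finrank ℝ ↥(S₂.space ⊓ S₁.space) = 1,
        Interlaced n S₁ S₂] ∧
      (Interlaced n S₁ S₂ → m + l + 1 = n) ∧
      List.TFAE [
        eigenvalue S₁ S₂ 0 = 1,
        IsotropicOn B (S₂.space ⊓ S₁.space),
        ∃ p, S₁.points ∩ S₂.points = {p}]) ∧
    -- the eigenvalues are a complete system of invariants
    (∀ (S₁ T₁ : Subsphere B m) (S₂ T₂ : Subsphere B l),
      GeneralPosition n S₁ S₂ → GeneralPosition n T₁ T₂ →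
      (MoebiusEquivalent S₁ S₂ T₁ T₂ ↔
        ∀ i < n - m, eigenvalue S₁ S₂ i = eigenvalue T₁ T₂ i)) := by
  refine ⟨fun S₁ S₂ h => ?_, fun S₁ T₁ S₂ T₂ hS hT =>
    moebiusEquivalent_iff_eigenvalue_eq hB (by omega) hV hS hT⟩
  obtain ⟨hbasis, hanti, hnonneg⟩ := exists_eigenbasis hB S₁ S₂ hV
  exact ⟨opA_selfAdjoint hB S₁ S₂, hbasis, hanti, hnonneg, h.position hB hmn hV⟩
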